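/- Let $M$ be a smooth manifold, let $\tau:E\to M$ be a Lie algebroid over $M$ with anchor $\rho:E\to TM$ and bracket $[\cdot,\cdot]$ on the sections of $E$, and for a vector bundle $\pi:P\to M$ let $\mathcal T^EP\to P$ be the prolongation, with fibre $\mathcal T^E_pP=\{(b,v)\in E_m\times T_pP : \rho(b)=T_p\pi(v)\}$ over $p\in P_m$ and anchor $\rho^1(p,b,v)=v$. The bracket of projectable sections $Z_j(p)=(p,\sigma_j(\pi(p)),X_j(p))$ is $[Z_1,Z_2](p)=(p,[\sigma_1,\sigma_2](\pi(p)),[X_1,X_2](p))$. The differential of a function $f$ on $P$ is $\langle d^{\mathcal T^EP}f,z\rangle=\rho^1(z)f$, and that of a 1-form is $d\alpha(Z_1,Z_2)=\rho^1(Z_1)(\alpha(Z_2))-\rho^1(Z_2)(\alpha(Z_1))-\alpha([Z_1,Z_2])$. For $a,b\in E_m$ let $b_a^V$ be the vector tangent at $t=0$ to $t\mapsto a+tb$; on $\mathcal T^EE$ put $S(a,b,v)=(a,0,b_a^V)$ and $\Delta(a)=(a,0,a_a^V)$. For a smooth $L:E\to\mathbb R$ put $\theta_L=S^*(dL)$,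 $\omega_L=-d\theta_L$, $E_L=\langle dL,\Delta\rangle-L$; $L$ is regular if $\omega_L$ is nondegenerate at every point. Let $L$ be a regular Lagrangian and $D\subset E$ a smooth vector subbundle. Write $\mathcal T^DD=\{(a,b,v)\in\mathcal T^ED : b\in D\}$. A solution of the constrained system $(L,D)$ is a smooth section $\Gamma$ of $\mathcal T^DD\to D$ with $S\Gamma=\Delta$ on $D$ such that for each $a\in D$ there is $\lambda\in E^*_{\tau(a)}$ vanishing on $D_{\tau(a)}$ with $\omega_L(\Gamma(a),w)-\langle dE_L,w\rangle=\langle\lambda,b\rangle$ for all $w=(a,b,v)\in\mathcal T^E_aE$. Assume that $(L,D)$ is regular, that is, it has exactly one solution $\Gamma_{(L,D)}$. Let $K\to M$ be a vector bundle, $\Psi:K\to E$ a vector bundle morphism over the identity of $M$, and $K^D_x=\{k\in K_x : \Psi(k)\in D_x\}$. The nonholonomic momentum map $J_{(L,D,\Psi)}$ sends $a\in E_x$ to the linear form $k\mapsto \Psi(k)_a^V(L)=\frac{d}{dt}\big|_{t=0}L(a+t\Psi(k))$ on $K^D_x$. For a smooth section $\sigma$ of $K$ with $\sigma(x)\in K^D_x$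 for all $x\in M$, put $J^\sigma_{(L,D,\Psi)}(a)=J_{(L,D,\Psi)}(a)(\sigma(\tau(a)))$. Let $(\Psi\circ\sigma)^c$ be the complete lift of the section $\Psi\circ\sigma$ of $E$; the complete lift $\eta^c$ of a section $\eta$ of $E$ is the section of $\mathcal T^EE$ whose component in $E$ at $a$ is $\eta(\tau(a))$ and which satisfies $\langle d\hat\mu,\eta^c\rangle=\widehat{d_\eta\mu}$ for every section $\mu$ of $E^*$, where $\hat\mu$ is the fibrewise linear function on $E$ defined by $\mu$ and $\langle d_\eta\mu,\zeta\rangle=\rho(\eta)\langle\mu,\zeta\rangle-\langle\mu,[\eta,\zeta]\rangle$. **Theorem (nonholonomic momentum equation).** On $D$, $$\big\langle d^{\mathcal T^ED}\big(J^\sigma_{(L,D,\Psi)}|_D\big),\Gamma_{(L,D)}\big\rangle=\big\langle d^{\mathcal T^EE}L,(\Psi\circ\sigma)^c\big\rangle\big|_D .$$ In particular, if $\langle d^{\mathcal T^EE}L,(\Psi\circ\sigma)^c\rangle|_D=0$, then $J^\sigma_{(L,D,\Psi)}|_D$ is a constant of the motion for the constrained dynamics: $\langle d^{\mathcal T^ED}(J^\sigma_{(L,D,\Psi)}|_D),\Gamma_{(L,D)}\rangle=0$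 on $D$, and $J^\sigma_{(L,D,\Psi)}$ is constant along every integral curve of the vector field $\rho^1(\Gamma_{(L,D)})$ on $D$. -/

import Mathlib

open Bundle
open scoped Manifold ContDiff

set_option linter.unusedSectionVars false

noncomputable section

namespace Nonholonomic

section Functions

variable {EM : Type*} [NormedAddCommGroup EM] [NormedSpace ℝ EM]
  {H : Type*} [TopologicalSpace H] (I : ModelWithCorners ℝ EM H)
  {M : Type*} [TopologicalSpace M] [ChartedSpace H M]

/-- The differential at `x` of a real function on a manifold; `dAt I f x v` is `v(f)`. -/
def dAt (f : M → ℝ) (x : M) : TangentSpace I x →ₗ[ℝ] ℝ :=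
  (mfderiv I 𝓘(ℝ, ℝ) f x : TangentSpace I x →L[ℝ] ℝ).toLinearMap

end Functions

section Bundles

variable {EM : Type*} [NormedAddCommGroup EM] [NormedSpace ℝ EM]
  {H : Type*} [TopologicalSpace H] (I : ModelWithCorners ℝ EM H)
  {M : Type*} [TopologicalSpace M] [ChartedSpace H M]
  (F : Type*) [NormedAddCommGroup F] [NormedSpace ℝ F]
  (E : M → Type*) [TopologicalSpace (TotalSpace F E)]
  [∀ x, AddCommGroup (E x)] [∀ x, Module ℝ (E x)] [∀ x, TopologicalSpace (E x)]
  [FiberBundle F E]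
  (F' : Type*) [NormedAddCommGroup F'] [NormedSpace ℝ F']
  (E' : M → Type*) [TopologicalSpace (TotalSpace F' E')]
  [∀ x, AddCommGroup (E' x)] [∀ x, Module ℝ (E' x)] [∀ x, TopologicalSpace (E' x)]
  [FiberBundle F' E']

/-- The smooth sections of the vector bundle `E → M`. -/
abbrev Sec [VectorBundle ℝ F E] : Type _ := ContMDiffSection I F ∞ E

/-- A smooth vector bundle morphism `E → E'` over the identity of `M`. -/
structure BundleMor where
  toFun : ∀ x, E x →ₗ[ℝ] E' x
  smooth : ContMDiff (I.prod 𝓘(ℝ, F)) (I.prod 𝓘(ℝ, F')) ∞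
    (fun p : TotalSpace F E => (⟨p.proj, toFun p.proj p.2⟩ : TotalSpace F' E'))

/-- A smooth section `μ` of the dual bundle `E*`.  Smoothness of `μ` is smoothness of the
fibrewise linear function `μ.hat` that it defines on the total space. -/
structure DualSec where
  toFun : ∀ x, E x →ₗ[ℝ] ℝ
  smooth : ContMDiff (I.prod 𝓘(ℝ, F)) 𝓘(ℝ, ℝ) ∞
    (fun p : TotalSpace F E => toFun p.proj p.2)

variable {I F E F' E'}

/-- The linear function on the total space of `E` defined by a section of `E*`. -/
def DualSec.hat (μ : DualSec I F E) (p : TotalSpace F E) : ℝ := μ.toFun p.proj p.2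

/-- A bundle morphism as a map of total spaces. -/
def BundleMor.total (Φ : BundleMor I F E F' E') (p : TotalSpace F E) : TotalSpace F' E' :=
  ⟨p.proj, Φ.toFun p.proj p.2⟩

/-- The identity morphism. -/
def BundleMor.id : BundleMor I F E F E where
  toFun _ := LinearMap.id
  smooth := contMDiff_id

/-- The composition of two bundle morphisms over the identity. -/
def BundleMor.comp {F'' : Type*} [NormedAddCommGroup F''] [NormedSpace ℝ F'']
    {E'' : M → Type*} [TopologicalSpace (TotalSpace F'' E'')]
    [∀ x, AddCommGroup (E'' x)] [∀ x, Module ℝ (E'' x)] [∀ x, TopologicalSpace (E'' x)]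
    [FiberBundle F'' E'']
    (Ψ : BundleMor I F' E' F'' E'') (Φ : BundleMor I F E F' E') : BundleMor I F E F'' E'' where
  toFun x := (Ψ.toFun x).comp (Φ.toFun x)
  smooth := Ψ.smooth.comp Φ.smooth

/-- The section `Φ ∘ σ`. -/
def BundleMor.mapSec [VectorBundle ℝ F E] [VectorBundle ℝ F' E']
    (Φ : BundleMor I F E F' E') (σ : Sec I F E) : Sec I F' E' where
  toFun x := Φ.toFun x (σ x)
  contMDiff_toFun := Φ.smooth.comp σ.contMDiff

/-- The section `f η`, for a smooth function `f` on `M`. -/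
def smulSec [VectorBundle ℝ F E] [ContMDiffVectorBundle ∞ F E I]
    (f : C^∞⟮I, M; 𝓘(ℝ, ℝ), ℝ⟯) (η : Sec I F E) : Sec I F E where
  toFun x := f x • η x
  contMDiff_toFun := f.contMDiff.smul_section η.contMDiff

end Bundles

section Algebroid

variable {EM : Type*} [NormedAddCommGroup EM] [NormedSpace ℝ EM]
  {H : Type*} [TopologicalSpace H] (I : ModelWithCorners ℝ EM H)
  {M : Type*} [TopologicalSpace M] [ChartedSpace H M] [IsManifold I ∞ M]
  (F : Type*) [NormedAddCommGroup F] [NormedSpace ℝ F]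
  (E : M → Type*) [TopologicalSpace (TotalSpace F E)]
  [∀ x, AddCommGroup (E x)] [∀ x, Module ℝ (E x)] [∀ x, TopologicalSpace (E x)]
  [FiberBundle F E] [VectorBundle ℝ F E] [ContMDiffVectorBundle ∞ F E I]

/-- A Lie algebroid structure on the vector bundle `E → M`: an anchor `E → TM` and a real Lie
algebra structure on the sections of `E` that satisfy the Leibniz rule
`[σ, f η] = f [σ, η] + (ρ(σ) f) η`. -/
structure LieAlgebroid where
  anchor : BundleMor I F E EM (TangentSpace I : M → Type _)
  bracket : Sec I F E →ₗ[ℝ] Sec I F E →ₗ[ℝ] Sec I F E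
  bracket_self : ∀ σ, bracket σ σ = 0
  jacobi : ∀ σ η ζ, bracket σ (bracket η ζ) + bracket η (bracket ζ σ)
    + bracket ζ (bracket σ η) = 0
  leibniz : ∀ (σ η : Sec I F E) (f : C^∞⟮I, M; 𝓘(ℝ, ℝ), ℝ⟯) (x : M),
    bracket σ (smulSec f η) x
      = f x • bracket σ η x + dAt I f x (anchor.toFun x (σ x)) • η x

variable {I F E}

/-- The Lie derivative `d_σ μ` of a section `μ` of `E*`, evaluated on a section `η`:
`⟨d_σ μ, η⟩ = ρ(σ) ⟨μ, η⟩ - ⟨μ, [σ, η]⟩`. -/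
def LieAlgebroid.lieDeriv (A : LieAlgebroid I F E) (σ : Sec I F E) (μ : DualSec I F E)
    (η : Sec I F E) (x : M) : ℝ :=
  dAt I (fun y => μ.toFun y (η y)) x (A.anchor.toFun x (σ x))
    - μ.toFun x (A.bracket σ η x)

end Algebroid

section Prolongation

variable {EM : Type*} [NormedAddCommGroup EM] [NormedSpace ℝ EM]
  {H : Type*} [TopologicalSpace H] {I : ModelWithCorners ℝ EM H}
  {M : Type*} [TopologicalSpace M] [ChartedSpace H M] [IsManifold I ∞ M]
  {F : Type*} [NormedAddCommGroup F] [NormedSpace ℝ F]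
  {E : M → Type*} [TopologicalSpace (TotalSpace F E)]
  [∀ x, AddCommGroup (E x)] [∀ x, Module ℝ (E x)] [∀ x, TopologicalSpace (E x)]
  [FiberBundle F E] [VectorBundle ℝ F E] [ContMDiffVectorBundle ∞ F E I]
  {F' : Type*} [NormedAddCommGroup F'] [NormedSpace ℝ F']
  {E' : M → Type*} [TopologicalSpace (TotalSpace F' E')]
  [∀ x, AddCommGroup (E' x)] [∀ x, Module ℝ (E' x)] [∀ x, TopologicalSpace (E' x)]
  [FiberBundle F' E'] [VectorBundle ℝ F' E'] [ContMDiffVectorBundle ∞ F' E' I]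
  {G : Type*} [NormedAddCommGroup G] [NormedSpace ℝ G]
  {P : M → Type*} [TopologicalSpace (TotalSpace G P)]
  [∀ x, AddCommGroup (P x)] [∀ x, Module ℝ (P x)] [∀ x, TopologicalSpace (P x)]
  [FiberBundle G P] [VectorBundle ℝ G P] [ContMDiffVectorBundle ∞ G P I]
  {G' : Type*} [NormedAddCommGroup G'] [NormedSpace ℝ G']
  {P' : M → Type*} [TopologicalSpace (TotalSpace G' P')]
  [∀ x, AddCommGroup (P' x)] [∀ x, Module ℝ (P' x)] [∀ x, TopologicalSpace (P' x)]
  [FiberBundle G' P'] [VectorBundle ℝ G' P'] [ContMDiffVectorBundle ∞ G' P' I]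

variable (I) in
/-- The tangent map `T_pπ : T_pP → T_{π(p)}M` of the bundle projection `π : P → M`. -/
def tangentProj (p : TotalSpace G P) :
    TangentSpace (I.prod 𝓘(ℝ, G)) p →ₗ[ℝ] TangentSpace I p.proj :=
  (mfderiv (I.prod 𝓘(ℝ, G)) I (TotalSpace.proj : TotalSpace G P → M) p).toLinearMap

/-- The fibre `{(b, v) ∈ E_m × T_pP | ρ(b) = T_pπ(v)}` over `p ∈ P_m` of the prolongation
`𝒯^E P` of the bundle `P → M` with respect to the anchored bundle `(E, ρ)`. -/
def Prol (ρ : BundleMor I F E EM (TangentSpace I : M → Type _)) (p : TotalSpace G P) :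
    Submodule ℝ (E p.proj × TangentSpace (I.prod 𝓘(ℝ, G)) p) :=
  LinearMap.eqLocus ((ρ.toFun p.proj).comp (LinearMap.fst ℝ _ _))
    ((tangentProj I p).comp (LinearMap.snd ℝ _ _))

/-- The projection `(p, b, v) ↦ b` of `𝒯^E P` to `E`. -/
def Prol.toE (ρ : BundleMor I F E EM (TangentSpace I : M → Type _)) (p : TotalSpace G P) :
    Prol ρ p →ₗ[ℝ] E p.proj :=
  (LinearMap.fst ℝ _ _).comp (Prol ρ p).subtype

/-- The anchor `ρ¹ : (p, b, v) ↦ v` of `𝒯^E P`. -/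
def Prol.anchor (ρ : BundleMor I F E EM (TangentSpace I : M → Type _)) (p : TotalSpace G P) :
    Prol ρ p →ₗ[ℝ] TangentSpace (I.prod 𝓘(ℝ, G)) p :=
  (LinearMap.snd ℝ _ _).comp (Prol ρ p).subtype

/-- The differential `⟨df, z⟩ = ρ¹(z)(f)` of a function `f` on `P`, as a 1-form on `𝒯^E P`. -/
def Prol.dFun (ρ : BundleMor I F E EM (TangentSpace I : M → Type _)) (f : TotalSpace G P → ℝ)
    (p : TotalSpace G P) : Prol ρ p →ₗ[ℝ] ℝ :=
  (dAt (I.prod 𝓘(ℝ, G)) f p).comp (Prol.anchor ρ p)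

/-- The tangent map of a bundle morphism `Ψ : P → P'`. -/
def BundleMor.tangentMap (Ψ : BundleMor I G P G' P') (p : TotalSpace G P) :
    TangentSpace (I.prod 𝓘(ℝ, G)) p →ₗ[ℝ] TangentSpace (I.prod 𝓘(ℝ, G')) (Ψ.total p) :=
  (mfderiv (I.prod 𝓘(ℝ, G)) (I.prod 𝓘(ℝ, G')) Ψ.total p).toLinearMap

theorem tangentProj_tangentMap (Ψ : BundleMor I G P G' P') (p : TotalSpace G P)
    (v : TangentSpace (I.prod 𝓘(ℝ, G)) p) :
    tangentProj I (Ψ.total p) (Ψ.tangentMap p v) = tangentProj I p v := by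
  have h1 : MDifferentiableAt (I.prod 𝓘(ℝ, G')) I
      (TotalSpace.proj : TotalSpace G' P' → M) (Ψ.total p) :=
    (contMDiff_proj (n := ∞) P').mdifferentiableAt (by simp)
  have h2 : MDifferentiableAt (I.prod 𝓘(ℝ, G)) (I.prod 𝓘(ℝ, G')) Ψ.total p :=
    Ψ.smooth.mdifferentiableAt (by simp)
  have h := mfderiv_comp p h1 h2
  exact (DFunLike.congr_fun h v).symm

/-- The prolongation `(p, b, v) ↦ (Ψ(p), Φ(b), TΨ(v))`, `𝒯^E P → 𝒯^{E'} P'`, of an admissible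
morphism `Φ : E → E'` of anchored bundles with respect to a bundle morphism `Ψ : P → P'`. -/
def Prol.map {ρ : BundleMor I F E EM (TangentSpace I : M → Type _)}
    {ρ' : BundleMor I F' E' EM (TangentSpace I : M → Type _)}
    (Φ : BundleMor I F E F' E') (hΦ : ∀ x b, ρ'.toFun x (Φ.toFun x b) = ρ.toFun x b)
    (Ψ : BundleMor I G P G' P') (p : TotalSpace G P) :
    Prol ρ p →ₗ[ℝ] Prol ρ' (Ψ.total p) :=
  LinearMap.codRestrict (Prol ρ' (Ψ.total p))
    (((Φ.toFun p.proj).comp (Prol.toE ρ p)).prod ((Ψ.tangentMap p).comp (Prol.anchor ρ p)))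
    (fun z => by
      show ρ'.toFun p.proj (Φ.toFun p.proj z.1.1)
        = tangentProj I (Ψ.total p) (Ψ.tangentMap p z.1.2)
      rw [hΦ, tangentProj_tangentMap]
      exact z.2)

/-- The vector `b_a^V` tangent at `t = 0` to the curve `t ↦ a + t b` in the total space. -/
def verticalVec (a : TotalSpace F E) (b : E a.proj) : TangentSpace (I.prod 𝓘(ℝ, F)) a :=
  (mfderiv 𝓘(ℝ, ℝ) (I.prod 𝓘(ℝ, F))
    (fun t : ℝ => (⟨a.proj, a.2 + t • b⟩ : TotalSpace F E)) 0 : ℝ →L[ℝ] EM × F) (1 : ℝ)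

theorem contMDiff_fibre (x : M) : ContMDiff 𝓘(ℝ, F) (I.prod 𝓘(ℝ, F)) ∞
    (fun y : F => (⟨x, (VectorBundle.continuousLinearEquivAt ℝ F E x).symm y⟩ :
      TotalSpace F E)) := by
  intro y
  have hx : x ∈ (trivializationAt F E x).baseSet := FiberBundle.mem_baseSet_trivializationAt F E x
  rw [(trivializationAt F E x).contMDiffAt_iff
    (by rw [Trivialization.mem_source]; exact hx)]
  refine ⟨contMDiffAt_const, ?_⟩
  have h : (fun y : F => ((trivializationAt F E x) (⟨x,
      (VectorBundle.continuousLinearEquivAt ℝ F E x).symm y⟩ : TotalSpace F E)).2) = id := by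
    funext y
    exact (VectorBundle.continuousLinearEquivAt ℝ F E x).apply_symm_apply y
  rw [h]
  exact contMDiffAt_id

theorem verticalVec_eq (a : TotalSpace F E) (b : E a.proj) :
    verticalVec (I := I) a b = (mfderiv 𝓘(ℝ, F) (I.prod 𝓘(ℝ, F))
      (fun y : F => (⟨a.proj, (VectorBundle.continuousLinearEquivAt ℝ F E a.proj).symm y⟩ :
        TotalSpace F E)) (VectorBundle.continuousLinearEquivAt ℝ F E a.proj a.2) :
      F →L[ℝ] EM × F) (VectorBundle.continuousLinearEquivAt ℝ F E a.proj b) := by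
  set c := VectorBundle.continuousLinearEquivAt ℝ F E a.proj with hc
  set ι : F → TotalSpace F E := fun y => ⟨a.proj, c.symm y⟩ with hι
  set l : ℝ → F := fun t => c a.2 + t • c b with hl
  have hfun : (fun t : ℝ => (⟨a.proj, a.2 + t • b⟩ : TotalSpace F E)) = ι ∘ l := by
    funext t
    simp [hι, hl]
  have hl' : HasDerivAt l (c b) 0 := by
    have h0 := ((hasDerivAt_id (0 : ℝ)).smul_const (c b)).const_add (c a.2)
    rw [one_smul] at h0
    exact h0
  have hl0 : l 0 = c a.2 := by simp [hl]
  have hιd : HasMFDerivAt 𝓘(ℝ, F) (I.prod 𝓘(ℝ, F)) ι (l 0)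
      (mfderiv 𝓘(ℝ, F) (I.prod 𝓘(ℝ, F)) ι (l 0)) :=
    ((contMDiff_fibre (I := I) (E := E) a.proj).mdifferentiableAt (by simp)).hasMFDerivAt
  have h := (hιd.comp 0 hl'.hasFDerivAt.hasMFDerivAt).mfderiv
  have h2 : verticalVec (I := I) a b
      = (mfderiv 𝓘(ℝ, F) (I.prod 𝓘(ℝ, F)) ι (l 0) : F →L[ℝ] EM × F) (c b) := by
    unfold verticalVec
    rw [hfun, h]
    show (mfderiv 𝓘(ℝ, F) (I.prod 𝓘(ℝ, F)) ι (l 0) : F →L[ℝ] EM × F) ((1 : ℝ) • c b) = _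
    rw [one_smul]
  rw [h2, hl0]

theorem tangentProj_verticalVec (a : TotalSpace F E) (b : E a.proj) :
    tangentProj I a (verticalVec (I := I) a b) = 0 := by
  rw [verticalVec_eq]
  obtain ⟨x, a⟩ := a
  set c := VectorBundle.continuousLinearEquivAt ℝ F E x with hc
  obtain ⟨y, rfl⟩ := c.symm.surjective a
  have hcy : c (c.symm y) = y := c.apply_symm_apply y
  have h1 : MDifferentiableAt (I.prod 𝓘(ℝ, F)) I (TotalSpace.proj : TotalSpace F E → M)
      ⟨x, c.symm y⟩ := (contMDiff_proj (n := ∞) E).mdifferentiableAt (by simp)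
  have h2 : MDifferentiableAt 𝓘(ℝ, F) (I.prod 𝓘(ℝ, F))
      (fun y : F => (⟨x, c.symm y⟩ : TotalSpace F E)) y :=
    (contMDiff_fibre (I := I) (E := E) x).mdifferentiableAt (by simp)
  have h := mfderiv_comp y h1 h2
  have h3 : mfderiv 𝓘(ℝ, F) I ((TotalSpace.proj : TotalSpace F E → M) ∘
      fun y : F => (⟨x, c.symm y⟩ : TotalSpace F E)) y = 0 := mfderiv_const
  rw [h3] at h
  show tangentProj I (⟨x, c.symm y⟩ : TotalSpace F E) ((mfderiv 𝓘(ℝ, F) (I.prod 𝓘(ℝ, F))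
    (fun y : F => (⟨x, c.symm y⟩ : TotalSpace F E)) (c (c.symm y)) : F →L[ℝ] EM × F) (c b)) = 0
  rw [hcy]
  exact (DFunLike.congr_fun h (c b)).symm

theorem verticalVec_linear (a : TotalSpace F E) : IsLinearMap ℝ (verticalVec (I := I) a) := by
  constructor
  · intro b b'
    rw [verticalVec_eq, verticalVec_eq, verticalVec_eq, map_add]
    exact map_add _ _ _
  · intro r b
    rw [verticalVec_eq, verticalVec_eq, map_smul]
    exact map_smul _ _ _

/-- The vertical lift `b ↦ (a, 0, b_a^V)`, `E_m → 𝒯^E_a E`. -/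
def verticalLift (ρ : BundleMor I F E EM (TangentSpace I : M → Type _)) (a : TotalSpace F E) :
    E a.proj →ₗ[ℝ] Prol ρ a :=
  LinearMap.codRestrict (Prol ρ a)
    ((0 : E a.proj →ₗ[ℝ] E a.proj).prod (verticalVec_linear (I := I) a).mk')
    (fun b => by
      show ρ.toFun a.proj 0 = tangentProj I a (verticalVec (I := I) a b)
      rw [tangentProj_verticalVec, map_zero])

/-- The vertical endomorphism `S(a, b, v) = (a, 0, b_a^V)` of `𝒯^E E`. -/
def verticalEnd (ρ : BundleMor I F E EM (TangentSpace I : M → Type _)) (a : TotalSpace F E) :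
    Prol ρ a →ₗ[ℝ] Prol ρ a :=
  (verticalLift ρ a).comp (Prol.toE ρ a)

/-- The Liouville section `Δ(a) = (a, 0, a_a^V)` of `𝒯^E E`. -/
def liouville (ρ : BundleMor I F E EM (TangentSpace I : M → Type _)) (a : TotalSpace F E) :
    Prol ρ a :=
  verticalLift ρ a a.2

variable (G P) in
/-- A smooth projectable section `p ↦ (p, σ(π(p)), X(p))` of `𝒯^E P`: `σ` is a smooth section
of `E` and `X` a smooth vector field on `P` that projects to `ρ(σ)`. -/
structure ProjSec (ρ : BundleMor I F E EM (TangentSpace I : M → Type _)) where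
  base : Sec I F E
  field : Sec (I.prod 𝓘(ℝ, G)) (EM × G)
    (TangentSpace (I.prod 𝓘(ℝ, G)) : TotalSpace G P → Type _)
  related : ∀ p : TotalSpace G P,
    ρ.toFun p.proj (base p.proj) = tangentProj I p (field p)

/-- The value at `p` of a projectable section of `𝒯^E P`. -/
def ProjSec.val {ρ : BundleMor I F E EM (TangentSpace I : M → Type _)} (Z : ProjSec G P ρ)
    (p : TotalSpace G P) : Prol ρ p :=
  ⟨(Z.base p.proj, Z.field p), Z.related p⟩

/-- `Z` is the bracket `[Z₁, Z₂](p) = (p, [σ₁, σ₂](π(p)), [X₁, X₂](p))` of the projectable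
sections `Z₁ = (σ₁, X₁)` and `Z₂ = (σ₂, X₂)` of `𝒯^E P`. -/
def ProjSec.IsBracket (A : LieAlgebroid I F E) (Z₁ Z₂ Z : ProjSec G P A.anchor) : Prop :=
  Z.base = A.bracket Z₁.base Z₂.base ∧
    ∀ p, Z.field p = VectorField.mlieBracket (I.prod 𝓘(ℝ, G)) Z₁.field Z₂.field p

/-- The 2-form `β` on `𝒯^E P` is the exterior differential of the 1-form `α`:
`β(Z₁, Z₂) = ρ¹(Z₁)(α(Z₂)) - ρ¹(Z₂)(α(Z₁)) - α([Z₁, Z₂])`.  Projectable sections suffice, since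
every element of `𝒯^E P` is the value of one; for the same reason `β` is unique.  It exists for smooth `α`, since the right-hand side at `p`
depends only on `Z₁(p)` and `Z₂(p)`. -/
def IsExtDeriv (A : LieAlgebroid I F E)
    (α : ∀ p : TotalSpace G P, Prol A.anchor p →ₗ[ℝ] ℝ)
    (β : ∀ p : TotalSpace G P, Prol A.anchor p →ₗ[ℝ] Prol A.anchor p →ₗ[ℝ] ℝ) : Prop :=
  ∀ Z₁ Z₂ Z : ProjSec G P A.anchor, ProjSec.IsBracket A Z₁ Z₂ Z → ∀ p,
    β p (Z₁.val p) (Z₂.val p)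
      = Prol.dFun A.anchor (fun q => α q (Z₂.val q)) p (Z₁.val p)
        - Prol.dFun A.anchor (fun q => α q (Z₁.val q)) p (Z₂.val p)
        - α p (Z.val p)

/-- The exterior differential `dα` of a 1-form `α` on `𝒯^E P`. -/
def extDeriv (A : LieAlgebroid I F E)
    (α : ∀ p : TotalSpace G P, Prol A.anchor p →ₗ[ℝ] ℝ) :
    ∀ p : TotalSpace G P, Prol A.anchor p →ₗ[ℝ] Prol A.anchor p →ₗ[ℝ] ℝ :=
  Classical.epsilon (IsExtDeriv A α)

/-- The Cartan 1-form `θ_L = S^*(dL)` on `𝒯^E E`. -/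
def cartanOne (A : LieAlgebroid I F E) (L : TotalSpace F E → ℝ) (a : TotalSpace F E) :
    Prol A.anchor a →ₗ[ℝ] ℝ :=
  (Prol.dFun A.anchor L a).comp (verticalEnd A.anchor a)

/-- The Cartan 2-form `ω_L = -dθ_L` on `𝒯^E E`. -/
def cartanTwo (A : LieAlgebroid I F E) (L : TotalSpace F E → ℝ) (a : TotalSpace F E) :
    Prol A.anchor a →ₗ[ℝ] Prol A.anchor a →ₗ[ℝ] ℝ :=
  -extDeriv A (cartanOne A L) a

/-- The energy `E_L = d_Δ L - L`. -/
def energy (A : LieAlgebroid I F E) (L : TotalSpace F E → ℝ) (a : TotalSpace F E) : ℝ :=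
  Prol.dFun A.anchor L a (liouville A.anchor a) - L a

/-- The Lagrangian `L` is regular: `ω_L` is nondegenerate at every point. -/
def IsRegularLagrangian (A : LieAlgebroid I F E) (L : TotalSpace F E → ℝ) : Prop :=
  ∀ a : TotalSpace F E, (cartanTwo A L a).Nondegenerate

/-- `z ∈ 𝒯^E_a E` is the value at `a` of the complete lift `σ^c`: it projects to `σ(τ(a))`, and
`d_z μ̂ = ⟨d_σ μ, a⟩` for each section `μ` of `E*`.  The right-hand side is computed with any
section `η` of `E` through `a`. -/
def IsCompleteLiftAt (A : LieAlgebroid I F E) (σ : Sec I F E) (a : TotalSpace F E)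
    (z : Prol A.anchor a) : Prop :=
  Prol.toE A.anchor a z = σ a.proj ∧
    ∀ (μ : DualSec I F E) (η : Sec I F E), η a.proj = a.2 →
      Prol.dFun A.anchor μ.hat a z = A.lieDeriv σ μ η a.proj

/-- The complete lift `σ^c` of a section `σ` of `E`, a section of `𝒯^E E`: at each `a` the unique
element of `𝒯^E_a E` with the two characterizing properties. -/
def completeLift (A : LieAlgebroid I F E) (σ : Sec I F E) (a : TotalSpace F E) :
    Prol A.anchor a :=
  Classical.epsilon (IsCompleteLiftAt A σ a)

end Prolongation

section Constrained

variable {EM : Type*} [NormedAddCommGroup EM] [NormedSpace ℝ EM]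
  {H : Type*} [TopologicalSpace H] {I : ModelWithCorners ℝ EM H}
  {M : Type*} [TopologicalSpace M] [ChartedSpace H M] [IsManifold I ∞ M]
  {F : Type*} [NormedAddCommGroup F] [NormedSpace ℝ F]
  {E : M → Type*} [TopologicalSpace (TotalSpace F E)]
  [∀ x, AddCommGroup (E x)] [∀ x, Module ℝ (E x)] [∀ x, TopologicalSpace (E x)]
  [FiberBundle F E] [VectorBundle ℝ F E] [ContMDiffVectorBundle ∞ F E I]
  {FD : Type*} [NormedAddCommGroup FD] [NormedSpace ℝ FD]
  {D : M → Type*} [TopologicalSpace (TotalSpace FD D)]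
  [∀ x, AddCommGroup (D x)] [∀ x, Module ℝ (D x)] [∀ x, TopologicalSpace (D x)]
  [FiberBundle FD D] [VectorBundle ℝ FD D] [ContMDiffVectorBundle ∞ FD D I]
  {FK : Type*} [NormedAddCommGroup FK] [NormedSpace ℝ FK]
  {K : M → Type*} [TopologicalSpace (TotalSpace FK K)]
  [∀ x, AddCommGroup (K x)] [∀ x, Module ℝ (K x)] [∀ x, TopologicalSpace (K x)]
  [FiberBundle FK K] [VectorBundle ℝ FK K] [ContMDiffVectorBundle ∞ FK K I]

/-- The inclusion `𝒯^D D → 𝒯^E E` induced by the inclusion `i : D → E`. -/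
def inclTEE (A : LieAlgebroid I F E) (i : BundleMor I FD D F E) (d : TotalSpace FD D) :
    Prol (A.anchor.comp i) d →ₗ[ℝ] Prol A.anchor (i.total d) :=
  Prol.map i (fun _ _ => rfl) i d

/-- The inclusion `𝒯^D D → 𝒯^E D` induced by the inclusion `i : D → E`. -/
def inclTED (A : LieAlgebroid I F E) (i : BundleMor I FD D F E) (d : TotalSpace FD D) :
    Prol (A.anchor.comp i) d →ₗ[ℝ] Prol A.anchor d :=
  Prol.map i (fun _ _ => rfl) BundleMor.id d

/-- The vector field `ρ¹(Γ)` on `D` of a section `Γ` of `𝒯^D D`. -/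
def dynField (A : LieAlgebroid I F E) (i : BundleMor I FD D F E)
    (Γ : ∀ d : TotalSpace FD D, Prol (A.anchor.comp i) d) (d : TotalSpace FD D) :
    TangentSpace (I.prod 𝓘(ℝ, FD)) d :=
  Prol.anchor (A.anchor.comp i) d (Γ d)

/-- `Γ` is a solution of the constrained Lagrangian system `(L, D)`, where `i : D → E` is the
inclusion of the constraint subbundle: a smooth section of `𝒯^D D` that is a SODE
(`S Γ = Δ` on `D`) and satisfies the Lagrange-d'Alembert equations: at each point of `D`,
`i_Γ ω_L - dE_L` is of the form `w ↦ ⟨lam, 𝒯τ(w)⟩` with `lam` in the annihilator of `D`. -/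
structure IsConstrainedSolution (A : LieAlgebroid I F E) (L : TotalSpace F E → ℝ)
    (i : BundleMor I FD D F E) (Γ : ∀ d : TotalSpace FD D, Prol (A.anchor.comp i) d) :
    Prop where
  smooth_base : ContMDiff (I.prod 𝓘(ℝ, FD)) (I.prod 𝓘(ℝ, FD)) ∞
    (fun d => (⟨d.proj, Prol.toE (A.anchor.comp i) d (Γ d)⟩ : TotalSpace FD D))
  smooth_field : ContMDiff (I.prod 𝓘(ℝ, FD)) (I.prod 𝓘(ℝ, FD)).tangent ∞
    (fun d => (⟨d, dynField A i Γ d⟩ :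
      TangentBundle (I.prod 𝓘(ℝ, FD)) (TotalSpace FD D)))
  sode : ∀ d, verticalEnd A.anchor (i.total d) (inclTEE A i d (Γ d))
    = liouville A.anchor (i.total d)
  lagrange_dAlembert : ∀ d, ∃ lam : E (i.total d).proj →ₗ[ℝ] ℝ,
    (∀ b : D d.proj, lam (i.toFun d.proj b) = 0) ∧
    ∀ w : Prol A.anchor (i.total d),
      cartanTwo A L (i.total d) (inclTEE A i d (Γ d)) w
        - Prol.dFun A.anchor (energy A L) (i.total d) w
        = lam (Prol.toE A.anchor (i.total d) w)

/-- The constrained system `(L, D)` is regular: the Lagrange-d'Alembert equations have a unique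
solution. -/
def IsRegularSystem (A : LieAlgebroid I F E) (L : TotalSpace F E → ℝ)
    (i : BundleMor I FD D F E) : Prop :=
  ∃! Γ : ∀ d : TotalSpace FD D, Prol (A.anchor.comp i) d, IsConstrainedSolution A L i Γ

/-- The unconstrained momentum map `J_{(L,Ψ)} : E → K^*`, `J_{(L,Ψ)}(a)(k) = Ψ(k)_a^V(L)`. -/
def momentum (A : LieAlgebroid I F E) (L : TotalSpace F E → ℝ) (Ψ : BundleMor I FK K F E)
    (a : TotalSpace F E) : K a.proj →ₗ[ℝ] ℝ :=
  (Prol.dFun A.anchor L a).comp ((verticalLift A.anchor a).comp (Ψ.toFun a.proj))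

/-- The subspace `K_x^D = {k ∈ K_x | Ψ(k) ∈ D_x}`. -/
def KD (i : BundleMor I FD D F E) (Ψ : BundleMor I FK K F E) (x : M) : Submodule ℝ (K x) :=
  (LinearMap.range (i.toFun x)).comap (Ψ.toFun x)

/-- The nonholonomic momentum map `J_{(L,D,Ψ)} : E → (K^D)^*`. -/
def nhMomentum (A : LieAlgebroid I F E) (L : TotalSpace F E → ℝ) (i : BundleMor I FD D F E)
    (Ψ : BundleMor I FK K F E) (a : TotalSpace F E) : KD i Ψ a.proj →ₗ[ℝ] ℝ :=
  (momentum A L Ψ a).comp (KD i Ψ a.proj).subtype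

/-- The function `J_{(L,D,Ψ)}^σ` on `E`, for a section `σ` of `K` with values in `K^D`. -/
def nhMomentumAlong (A : LieAlgebroid I F E) (L : TotalSpace F E → ℝ)
    (i : BundleMor I FD D F E) (Ψ : BundleMor I FK K F E) (σ : Sec I FK K)
    (hσ : ∀ x, σ x ∈ KD i Ψ x) (a : TotalSpace F E) : ℝ :=
  nhMomentum A L i Ψ a ⟨σ a.proj, hσ a.proj⟩

/-- The function `f` on `D` is a constant of the motion for `Γ`: `d_Γ f = 0` on `D`, and `f` is
constant along each integral curve, on any interval `s`, of the vector field `ρ¹(Γ)`. -/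
def IsConstantOfMotion (A : LieAlgebroid I F E) (i : BundleMor I FD D F E)
    (Γ : ∀ d : TotalSpace FD D, Prol (A.anchor.comp i) d) (f : TotalSpace FD D → ℝ) : Prop :=
  (∀ d, Prol.dFun A.anchor f d (inclTED A i d (Γ d)) = 0) ∧
    ∀ (γ : ℝ → TotalSpace FD D) (s : Set ℝ), s.OrdConnected →
      IsMIntegralCurveOn (I := I.prod 𝓘(ℝ, FD)) γ (dynField A i Γ) s →
      ∀ t ∈ s, ∀ t' ∈ s, f (γ t) = f (γ t')

end Constrained

end Nonholonomic

end

open VectorField Filter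
open scoped Topology

noncomputable section

namespace Nonholonomic

/-! ### Directional derivatives and the Lie bracket as a commutator of derivations. -/

section Functions

variable {EM : Type*} [NormedAddCommGroup EM] [NormedSpace ℝ EM]
  {H : Type*} [TopologicalSpace H] {I : ModelWithCorners ℝ EM H}
  {M : Type*} [TopologicalSpace M] [ChartedSpace H M]
  {EN : Type*} [NormedAddCommGroup EN] [NormedSpace ℝ EN]
  {HN : Type*} [TopologicalSpace HN] {IN : ModelWithCorners ℝ EN HN}
  {N : Type*} [TopologicalSpace N] [ChartedSpace HN N]

/-! Write η = Ψ∘σ, with vertical lift η^V and complete lift η^c. The momentum along σ is the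
function η^V(L), so the theorem compares Γ(η^V L) with η^c(L). The heart is an identity that
involves no constraint (`cartanTwo_sub_dFun_energy`): if S z = Δ at a, then ω_L(z, η^c) - dE_L(η^c)
= η^c(L) - z(η^V L). For z = Γ(a) the Lagrange-d'Alembert equations say that the left side is ⟨λ,
η(τ(a))⟩, and this is zero because η takes values in D and λ annihilates D.

To prove the identity, extend z to a projectable section Z = (s, X). Since θ_L(Z) = s^V(L), the
formula for the exterior differential gives ω_L(Z, η^c) = η^c(s^V L) - X(η^V L) + [s, η]^V(L). The
relation [η^c, s^V] = [η, s]^V (`mlieBracket_completeLiftField_verticalVec`) turns the first and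
last terms into s^V(η^c L), which at a is Δ(η^c L) because S z = Δ. The relation [η^c, Δ] = 0
(`mlieBracket_completeLiftField_liouville`) turns this into η^c(ΔL), which cancels against the same
term of dE_L(η^c) = η^c(ΔL) - η^c(L).

Both bracket relations are checked on functions: a tangent vector of the total space is determined
by its projection to M and its action on fibrewise linear functions
(`eq_zero_of_forall_dAt_proj_hat`).

The remaining work shows that the objects chosen by `Classical.epsilon` have their defining
properties. Complete lifts exist because the Lie derivative is tensorial (`lieDeriv_congr`), and
they are smooth. The form dθ_L exists for the same kind of reason (`cartanAux_congr`); reading off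
its values also requires brackets of projectable sections, hence that the anchor respects brackets
(`dAt_anchor_bracket`), which follows from Jacobi and Leibniz. -/

theorem dAt_add {f g : M → ℝ} {x : M} (hf : MDifferentiableAt I 𝓘(ℝ, ℝ) f x)
    (hg : MDifferentiableAt I 𝓘(ℝ, ℝ) g x) (v : TangentSpace I x) :
    dAt I (fun y => f y + g y) x v = dAt I f x v + dAt I g x v := by
  have h := (hf.hasMFDerivAt.add hg.hasMFDerivAt).mfderiv
  exact DFunLike.congr_fun h v

theorem dAt_sub {f g : M → ℝ} {x : M} (hf : MDifferentiableAt I 𝓘(ℝ, ℝ) f x)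
    (hg : MDifferentiableAt I 𝓘(ℝ, ℝ) g x) (v : TangentSpace I x) :
    dAt I (fun y => f y - g y) x v = dAt I f x v - dAt I g x v := by
  have h := (hf.hasMFDerivAt.sub hg.hasMFDerivAt).mfderiv
  exact DFunLike.congr_fun h v

theorem dAt_mul {f g : M → ℝ} {x : M} (hf : MDifferentiableAt I 𝓘(ℝ, ℝ) f x)
    (hg : MDifferentiableAt I 𝓘(ℝ, ℝ) g x) (v : TangentSpace I x) :
    dAt I (fun y => f y * g y) x v = f x * dAt I g x v + g x * dAt I f x v := by
  have h := (hf.hasMFDerivAt.mul hg.hasMFDerivAt).mfderiv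
  exact DFunLike.congr_fun h v

theorem dAt_const (c : ℝ) (x : M) (v : TangentSpace I x) :
    dAt I (fun _ : M => c) x v = 0 := by
  have h : mfderiv I 𝓘(ℝ, ℝ) (fun _ : M => c) x = 0 := mfderiv_const
  exact DFunLike.congr_fun h v

theorem dAt_congr {f g : M → ℝ} {x : M} (h : f =ᶠ[𝓝 x] g) (v : TangentSpace I x) :
    dAt I f x v = dAt I g x v :=
  DFunLike.congr_fun h.mfderiv_eq v

theorem dAt_comp {f : N → ℝ} {φ : M → N} {x : M} (hf : MDifferentiableAt IN 𝓘(ℝ, ℝ) f (φ x))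
    (hφ : MDifferentiableAt I IN φ x) (v : TangentSpace I x) :
    dAt I (fun y => f (φ y)) x v = dAt IN f (φ x) (mfderiv I IN φ x v) :=
  DFunLike.congr_fun (mfderiv_comp x hf hφ) v

/-- The derivative of a smooth function along a smooth vector field is smooth. -/
theorem contMDiff_dAt [IsManifold I ∞ M] {f : M → ℝ} (hf : ContMDiff I 𝓘(ℝ, ℝ) ∞ f)
    {X : ∀ x : M, TangentSpace I x}
    (hX : ContMDiff I I.tangent ∞ (fun x => (⟨x, X x⟩ : TangentBundle I M))) :
    ContMDiff I 𝓘(ℝ, ℝ) ∞ (fun x => dAt I f x (X x)) := by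
  have : IsManifold I 1 M := IsManifold.of_le (n := ∞) (by simp)
  have h1 : ContMDiff I 𝓘(ℝ, ℝ).tangent ∞ (fun x => tangentMap I 𝓘(ℝ, ℝ) f ⟨x, X x⟩) :=
    (hf.contMDiff_tangentMap (m := ∞) (by simp)).comp hX
  exact (contMDiff_snd_tangentBundle_modelSpace ℝ 𝓘(ℝ, ℝ)).comp h1

/-- A vector field in the chart at `x`, as a map of the model vector space. -/
def chartField (X : ∀ x : M, TangentSpace I x) (x : M) : EM → EM :=
  mpullbackWithin 𝓘(ℝ, EM) I (extChartAt I x).symm X (Set.range I)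

/-- The chart field is X multiplied by the inverse of the derivative of the inverse chart, so the
chain rule cancels the two. Without boundary the range of `I` is everything, and derivatives within
it are ordinary ones. -/
theorem dAt_eq_fderiv_chartField [I.Boundaryless] [IsManifold I ∞ M] {f : M → ℝ}
    (hf : ContMDiff I 𝓘(ℝ, ℝ) ∞ f) (X : ∀ x : M, TangentSpace I x) (x : M) {y : EM}
    (hy : y ∈ (extChartAt I x).target) :
    dAt I f ((extChartAt I x).symm y) (X ((extChartAt I x).symm y))
      = fderiv ℝ (f ∘ (extChartAt I x).symm) y (chartField X x y) := by
  have : IsManifold I 1 M := IsManifold.of_le (n := ∞) (by simp)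
  have hinv := isInvertible_mfderivWithin_extChartAt_symm (I := I) hy
  have hd : MDifferentiableAt 𝓘(ℝ, EM) I (extChartAt I x).symm y := by
    have := mdifferentiableWithinAt_extChartAt_symm (I := I) hy
    rwa [I.range_eq_univ, mdifferentiableWithinAt_univ] at this
  have hcomp := mfderiv_comp y (hf.mdifferentiableAt (x := (extChartAt I x).symm y) (by simp)) hd
  rw [mfderiv_eq_fderiv] at hcomp
  rw [hcomp]
  unfold chartField
  rw [mpullbackWithin_apply]
  obtain ⟨A, hA⟩ := hinv
  rw [← hA, ContinuousLinearMap.inverse_equiv]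
  have hA' : mfderiv 𝓘(ℝ, EM) I (extChartAt I x).symm y = A := by
    rw [hA, I.range_eq_univ, mfderivWithin_univ]
  rw [hA']
  show _ = mfderiv I 𝓘(ℝ, ℝ) f ((extChartAt I x).symm y) (A (A.symm _))
  rw [A.apply_symm_apply]
  rfl

/-- The derivatives of the chart and of its inverse at x are mutually inverse, so the two `inverse`
operations cancel. This is what recovers the chart expression of a manifold Lie bracket at the
centre of the chart. -/
theorem chartField_eq_of_eq_inverse [IsManifold I ∞ M] (Z : ∀ x : M, TangentSpace I x) (x : M)
    (w : EM)
    (h : Z x = (mfderiv I 𝓘(ℝ, EM) (extChartAt I x) x : EM →L[ℝ] EM).inverse w) :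
    chartField Z x (extChartAt I x x) = w := by
  have : IsManifold I 1 M := IsManifold.of_le (n := ∞) (by simp)
  have hZ : ∀ y : M, y = x → (Z y : EM) = Z x := by rintro y rfl; rfl
  set A : EM →L[ℝ] EM :=
    mfderivWithin 𝓘(ℝ, EM) I (extChartAt I x).symm (Set.range I) (extChartAt I x x) with hA
  set B : EM →L[ℝ] EM := mfderiv I 𝓘(ℝ, EM) (extChartAt I x) x with hB
  have hAB : A.comp B = ContinuousLinearMap.id ℝ EM :=
    mfderivWithin_extChartAt_symm_comp_mfderiv_extChartAt' (I := I) (mem_extChartAt_source x)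
  have hBA : B.comp A = ContinuousLinearMap.id ℝ EM :=
    mfderiv_extChartAt_comp_mfderivWithin_extChartAt_symm' (I := I) (mem_extChartAt_source x)
  show A.inverse (Z ((extChartAt I x).symm (extChartAt I x x)) : EM) = w
  rw [hZ _ (extChartAt_to_inv x), h]
  let e : EM ≃L[ℝ] EM := ContinuousLinearEquiv.equivOfInverse A B
    (fun v => DFunLike.congr_fun hBA v) (fun v => DFunLike.congr_fun hAB v)
  have he : ∀ A' : EM →L[ℝ] EM, A' = e → ∀ u, A'.inverse u = e.symm u := by
    rintro _ rfl u
    rw [ContinuousLinearMap.inverse_equiv]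
    rfl
  have he' : ∀ B' : EM →L[ℝ] EM, B' = e.symm → B'.inverse w = e w := by
    rintro _ rfl
    rw [ContinuousLinearMap.inverse_equiv]
    rfl
  refine (he A rfl _).trans ?_
  refine (congrArg e.symm (he' B rfl)).trans ?_
  exact e.symm_apply_apply w

/-- The Lie bracket of vector fields, as a derivation of smooth functions. -/
theorem dAt_mlieBracket [I.Boundaryless] [IsManifold I ∞ M] [CompleteSpace EM] {f : M → ℝ}
    (hf : ContMDiff I 𝓘(ℝ, ℝ) ∞ f) {X Y : ∀ x : M, TangentSpace I x}
    (hX : ContMDiff I I.tangent ∞ (fun x => (⟨x, X x⟩ : TangentBundle I M)))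
    (hY : ContMDiff I I.tangent ∞ (fun x => (⟨x, Y x⟩ : TangentBundle I M))) (x : M) :
    dAt I f x (mlieBracket I X Y x)
      = dAt I (fun y => dAt I f y (Y y)) x (X x) - dAt I (fun y => dAt I f y (X y)) x (Y x) := by
  have : IsManifold I 1 M := IsManifold.of_le (n := ∞) (by simp)
  have : IsManifold I 2 M := IsManifold.of_le (n := ∞) (by norm_cast)
  set φ := extChartAt I x with hφ
  have hx : φ.symm (φ x) = x := extChartAt_to_inv x
  have hxt : φ x ∈ φ.target := mem_extChartAt_target x
  have htn : φ.target ∈ 𝓝 (φ x) := extChartAt_target_mem_nhds x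
  set g : EM → ℝ := f ∘ φ.symm with hg
  have hsm : ∀ {h : M → ℝ}, ContMDiff I 𝓘(ℝ, ℝ) ∞ h → ContDiffAt ℝ ∞ (h ∘ φ.symm) (φ x) := by
    intro h hh
    have h1 : ContMDiffAt 𝓘(ℝ, EM) I ∞ φ.symm (φ x) := by
      have := contMDiffWithinAt_extChartAt_symm_range (n := ∞) (I := I) x hxt
      rwa [I.range_eq_univ, contMDiffWithinAt_univ] at this
    exact (hh.contMDiffAt.comp (φ x) h1).contDiffAt
  have hgd : ContDiffAt ℝ ∞ g (φ x) := hsm hf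
  have key : ∀ {h : M → ℝ}, ContMDiff I 𝓘(ℝ, ℝ) ∞ h → ∀ Z : ∀ x : M, TangentSpace I x,
      dAt I h x (Z x) = fderiv ℝ (h ∘ φ.symm) (φ x) (chartField Z x (φ x)) := by
    intro h hh Z
    have := dAt_eq_fderiv_chartField hh Z x hxt
    rw [← hφ] at this
    rw [← this, hx]
  have hdiff : ∀ {Z : ∀ x : M, TangentSpace I x},
      ContMDiff I I.tangent ∞ (fun x => (⟨x, Z x⟩ : TangentBundle I M)) →
      DifferentiableAt ℝ (chartField Z x) (φ x) := by
    intro Z hZ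
    have h1 : MDifferentiableWithinAt I I.tangent (fun x => (Z x : TangentBundle I M)) Set.univ x :=
      (hZ.mdifferentiableAt (by simp)).mdifferentiableWithinAt
    have h2 := h1.differentiableWithinAt_mpullbackWithin_vectorField
    rw [Set.preimage_univ, Set.univ_inter] at h2
    rw [I.range_eq_univ] at h2
    unfold chartField
    rw [I.range_eq_univ]
    exact h2.differentiableAt Filter.univ_mem
  have hg1 : DifferentiableAt ℝ (fderiv ℝ g) (φ x) :=
    (hgd.fderiv_right (m := 1) (by norm_cast)).differentiableAt (by simp)
  -- In the chart, W(Zf) is a Hessian term plus a first-order term. Antisymmetrizing removes the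
  -- Hessian, by symmetry of second derivatives, and leaves the coordinate bracket.
  have iter : ∀ {Z : ∀ x : M, TangentSpace I x} (W : ∀ x : M, TangentSpace I x),
      ContMDiff I I.tangent ∞ (fun x => (⟨x, Z x⟩ : TangentBundle I M)) →
      dAt I (fun y => dAt I f y (Z y)) x (W x)
        = fderiv ℝ (fderiv ℝ g) (φ x) (chartField W x (φ x)) (chartField Z x (φ x))
          + fderiv ℝ g (φ x) (fderiv ℝ (chartField Z x) (φ x) (chartField W x (φ x))) := by
    intro Z W hZ
    rw [key (contMDiff_dAt hf hZ) W]
    have he : (fun y => dAt I f y (Z y)) ∘ φ.symm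
        =ᶠ[𝓝 (φ x)] fun y => fderiv ℝ g y (chartField Z x y) := by
      filter_upwards [htn] with y hy
      exact dAt_eq_fderiv_chartField hf Z x hy
    rw [he.fderiv_eq, fderiv_clm_apply hg1 (hdiff hZ)]
    simp [add_comm]
  rw [iter X hY, iter Y hX]
  have hsymm : IsSymmSndFDerivAt ℝ g (φ x) := hgd.isSymmSndFDerivAt (by
    rw [minSmoothness_of_isRCLikeNormedField]; norm_cast)
  rw [hsymm (chartField Y x (φ x)) (chartField X x (φ x))]
  have hbr : dAt I f x (mlieBracket I X Y x)
      = fderiv ℝ g (φ x) (lieBracket ℝ (chartField X x) (chartField Y x) (φ x)) := by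
    rw [key hf (mlieBracket I X Y)]
    congr 1
    rw [← lieBracketWithin_univ]
    refine chartField_eq_of_eq_inverse _ _ _ ?_
    rw [mlieBracket, mlieBracketWithin_apply, Set.preimage_univ, Set.univ_inter, I.range_eq_univ]
    unfold chartField
    rw [I.range_eq_univ]
  rw [hbr, lieBracket_eq]
  simp only [map_sub]
  ring

end Functions

/-! ### Globally defined frames with cutoff; separation of tangent vectors; tensoriality. -/

section Frames

variable {EM : Type*} [NormedAddCommGroup EM] [NormedSpace ℝ EM] [FiniteDimensional ℝ EM]
  {H : Type*} [TopologicalSpace H] {I : ModelWithCorners ℝ EM H}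
  {M : Type*} [TopologicalSpace M] [T2Space M] [ChartedSpace H M] [IsManifold I ∞ M]

/-- Tangent vectors are separated by smooth functions. -/
theorem eq_zero_of_forall_dAt {x : M} {v : TangentSpace I x}
    (h : ∀ f : C^∞⟮I, M; 𝓘(ℝ, ℝ), ℝ⟯, dAt I f x v = 0) : v = 0 := by
  have : IsManifold I 1 M := IsManifold.of_le (n := ∞) (by simp)
  obtain ⟨ψ⟩ : Nonempty (SmoothBumpFunction I x) := inferInstance
  have hinj := (isInvertible_mfderiv_extChartAt (I := I) (mem_extChartAt_source x)).injective
  apply hinj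
  rw [map_zero]
  refine SeparatingDual.eq_zero_of_forall_dual_eq_zero (R := ℝ) (V := EM) fun l => ?_
  have hφ : ContMDiffOn I 𝓘(ℝ, EM) ∞ (extChartAt I x) (chartAt H x).source :=
    contMDiffOn_extChartAt
  -- The test functions are linear forms of the chart, cut off so as to be smooth on all of M.
  have hf : ContMDiff I 𝓘(ℝ, ℝ) ∞ (fun y => ψ y • l (extChartAt I x y)) :=
    ψ.contMDiff_smul (l.contMDiff.comp_contMDiffOn hφ)
  have h1 := h ⟨_, hf⟩
  have he : (fun y => ψ y • l (extChartAt I x y)) =ᶠ[𝓝 x] fun y => l (extChartAt I x y) := by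
    filter_upwards [ψ.eventuallyEq_one] with y hy
    rw [hy]
    exact one_smul _ _
  have h2 : dAt I (fun y => l (extChartAt I x y)) x v = 0 := (dAt_congr he v).symm.trans h1
  rw [dAt_comp (f := l) (l.contMDiff.mdifferentiableAt (n := ∞) (by simp))
    (mdifferentiableAt_extChartAt (by simp))] at h2
  have h3 : mfderiv 𝓘(ℝ, EM) 𝓘(ℝ, ℝ) l (extChartAt I x x) = l := by
    rw [mfderiv_eq_fderiv]; exact l.fderiv
  have h4 : (mfderiv 𝓘(ℝ, EM) 𝓘(ℝ, ℝ) l (extChartAt I x x) : EM →L[ℝ] ℝ)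
    (mfderiv I 𝓘(ℝ, EM) (extChartAt I x) x v) = 0 := h2
  rw [h3] at h4
  exact h4

variable {F : Type*} [NormedAddCommGroup F] [NormedSpace ℝ F]
  {E : M → Type*} [TopologicalSpace (TotalSpace F E)]
  [∀ x, AddCommGroup (E x)] [∀ x, Module ℝ (E x)] [∀ x, TopologicalSpace (E x)]
  [FiberBundle F E] [VectorBundle ℝ F E] [ContMDiffVectorBundle ∞ F E I]

variable (I F E) in
/-- Smooth morphisms between the trivial bundle with fibre `F` and `E`, defined on all of `M`,
whose composition is the multiplication by a function that is `1` near `x₀`. -/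
structure BumpFrame (x₀ : M) where
  bump : C^∞⟮I, M; 𝓘(ℝ, ℝ), ℝ⟯
  frame : ∀ x, F →ₗ[ℝ] E x
  coord : ∀ x, E x →ₗ[ℝ] F
  frame_smooth : ContMDiff (I.prod 𝓘(ℝ, F)) (I.prod 𝓘(ℝ, F)) ∞
    (fun p : M × F => (⟨p.1, frame p.1 p.2⟩ : TotalSpace F E))
  coord_smooth : ContMDiff (I.prod 𝓘(ℝ, F)) 𝓘(ℝ, F) ∞
    (fun q : TotalSpace F E => coord q.proj q.2)
  frame_coord : ∀ x v, frame x (coord x v) = bump x • v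
  bump_eq_one : ∀ᶠ x in 𝓝 x₀, bump x = 1

/-- A local trivialization and its inverse are each multiplied by a bump function ψ supported in the
base set. Each map carries one factor, so the composition is multiplication by ψ². -/
theorem nonempty_bumpFrame (x₀ : M) : Nonempty (BumpFrame I F E x₀) := by
  set e := trivializationAt F E x₀ with he
  obtain ⟨ψ, -, hψ⟩ := (SmoothBumpFunction.nhds_basis_tsupport (I := I) x₀).mem_iff.1
    (e.open_baseSet.mem_nhds (FiberBundle.mem_baseSet_trivializationAt F E x₀))
  -- Since the closed support lies in the base set, ψ vanishes near every outside point, so both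
  -- maps are locally zero there and hence smooth.
  have hzero : ∀ x, x ∉ e.baseSet → ∀ᶠ y in 𝓝 x, ψ y = 0 := fun x hx =>
    notMem_tsupport_iff_eventuallyEq.1 fun h => hx (hψ h)
  refine ⟨{
    bump := ⟨fun x => ψ x * ψ x, ψ.contMDiff.mul ψ.contMDiff⟩
    frame := fun x => ψ x • e.symmₗ ℝ x
    coord := fun x => ψ x • e.linearMapAt ℝ x
    frame_smooth := ?_
    coord_smooth := ?_
    frame_coord := ?_
    bump_eq_one := ?_ }⟩
  · rintro ⟨x, y⟩
    by_cases hx : x ∈ e.baseSet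
    · rw [e.contMDiffAt_iff (by rw [Trivialization.mem_source]; exact hx)]
      refine ⟨contMDiffAt_fst, ?_⟩
      have h1 : ContMDiffAt (I.prod 𝓘(ℝ, F)) 𝓘(ℝ, F) ∞ (fun p : M × F => ψ p.1 • p.2) (x, y) :=
        (ψ.contMDiff.contMDiffAt.comp (x, y) contMDiffAt_fst).smul contMDiffAt_snd
      refine h1.congr_of_eventuallyEq ?_
      have : ∀ᶠ p : M × F in 𝓝 (x, y), p.1 ∈ e.baseSet :=
        continuousAt_fst.eventually (e.open_baseSet.mem_nhds hx)
      filter_upwards [this] with p hp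
      have h2 := e.coe_linearMapAt_of_mem (R := ℝ) hp
      show (e ⟨p.1, ψ p.1 • e.symmₗ ℝ p.1 p.2⟩).2 = _
      have h3 : (e ⟨p.1, ψ p.1 • e.symmₗ ℝ p.1 p.2⟩).2
        = e.linearMapAt ℝ p.1 (ψ p.1 • e.symmₗ ℝ p.1 p.2) := by rw [h2]
      rw [h3, map_smul, e.linearMapAt_symmₗ hp]
    · have h0 : ContMDiffAt (I.prod 𝓘(ℝ, F)) (I.prod 𝓘(ℝ, F)) ∞
          (fun p : M × F => zeroSection F E p.1) (x, y) :=
        (contMDiff_zeroSection ℝ E).contMDiffAt.comp (x, y) contMDiffAt_fst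
      refine h0.congr_of_eventuallyEq ?_
      have : ∀ᶠ p : M × F in 𝓝 (x, y), ψ p.1 = 0 :=
        Tendsto.eventually (p := fun z => ψ z = 0)
          (continuousAt_fst (p := (x, y))) (hzero x hx)
      filter_upwards [this] with p hp
      simp [hp, zeroSection]
  · intro q
    by_cases hx : q.proj ∈ e.baseSet
    · have hid : ContMDiffAt (I.prod 𝓘(ℝ, F)) (I.prod 𝓘(ℝ, F)) ∞
          (fun q : TotalSpace F E => q) q := contMDiffAt_id
      rw [e.contMDiffAt_iff (by rw [Trivialization.mem_source]; exact hx)] at hid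
      have h1 : ContMDiffAt (I.prod 𝓘(ℝ, F)) 𝓘(ℝ, F) ∞
          (fun p : TotalSpace F E => ψ p.proj • (e p).2) q :=
        (ψ.contMDiff.contMDiffAt.comp q hid.1).smul hid.2
      refine h1.congr_of_eventuallyEq ?_
      have : ∀ᶠ p : TotalSpace F E in 𝓝 q, p.proj ∈ e.baseSet :=
        hid.1.continuousAt.eventually (e.open_baseSet.mem_nhds hx)
      filter_upwards [this] with p hp
      have h2 := e.coe_linearMapAt_of_mem (R := ℝ) hp
      show ψ p.proj • (e.linearMapAt ℝ p.proj p.2) = _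
      rw [h2]
    · refine (contMDiffAt_const (c := (0 : F))).congr_of_eventuallyEq ?_
      have : ∀ᶠ p : TotalSpace F E in 𝓝 q, ψ p.proj = 0 :=
        (contMDiff_proj (n := ∞) (IB := I) E).continuous.continuousAt.eventually (hzero _ hx)
      filter_upwards [this] with p hp
      simp [hp]
  · intro x v
    show ψ x • e.symmₗ ℝ x (ψ x • e.linearMapAt ℝ x v) = (ψ x * ψ x) • v
    by_cases hx : x ∈ e.baseSet
    · rw [map_smul, e.symmₗ_linearMapAt hx, smul_smul]
    · simp [(hzero x hx).self_of_nhds]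
  · filter_upwards [ψ.eventuallyEq_one] with y hy
    show ψ y * ψ y = 1
    rw [hy]
    simp

namespace BumpFrame

variable {x₀ : M} (B : BumpFrame I F E x₀)

theorem frame_coord_self (v : E x₀) : B.frame x₀ (B.coord x₀ v) = v := by
  rw [B.frame_coord, B.bump_eq_one.self_of_nhds, one_smul]

/-- The section of `E` with constant coordinates. -/
def sec (y : F) : Sec I F E where
  toFun x := B.frame x y
  contMDiff_toFun := B.frame_smooth.comp (contMDiff_id.prodMk contMDiff_const)

/-- The section of `E*` that is the composition of the coordinates with a linear form. -/
def dualSec (l : F →L[ℝ] ℝ) : DualSec I F E where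
  toFun x := l.toLinearMap.comp (B.coord x)
  smooth := l.contMDiff.comp B.coord_smooth

/-- The map `(x, y) ↦ Σ yᵢ eᵢ(x)`. -/
def frameMap (p : M × F) : TotalSpace F E := ⟨p.1, B.frame p.1 p.2⟩

/-- The coordinates of a point of `E`. -/
def coordMap (q : TotalSpace F E) : M × F := (q.proj, B.coord q.proj q.2)

theorem contMDiff_coordMap :
    ContMDiff (I.prod 𝓘(ℝ, F)) (I.prod 𝓘(ℝ, F)) ∞ B.coordMap :=
  (contMDiff_proj E).prodMk B.coord_smooth

theorem frameMap_coordMap {q : TotalSpace F E} (hq : B.bump q.proj = 1) :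
    B.frameMap (B.coordMap q) = q := by
  show (⟨q.proj, B.frame q.proj (B.coord q.proj q.2)⟩ : TotalSpace F E) = q
  rw [B.frame_coord, hq, one_smul]

theorem eventually_bump_proj (v : E x₀) :
    ∀ᶠ q : TotalSpace F E in 𝓝 (⟨x₀, v⟩ : TotalSpace F E), B.bump q.proj = 1 :=
  Tendsto.eventually (p := fun x => B.bump x = 1)
    (contMDiff_proj (n := ∞) (F := F) (IB := I) (𝕜 := ℝ) E).continuous.continuousAt B.bump_eq_one

/-- Near the point the composition of the two maps is the identity. A tangent vector is thereby
recovered from its base and fibre coordinates. -/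
theorem mfderiv_frameMap_mfderiv_coordMap (a : E x₀)
    (v : TangentSpace (I.prod 𝓘(ℝ, F)) (⟨x₀, a⟩ : TotalSpace F E)) :
    (mfderiv (I.prod 𝓘(ℝ, F)) (I.prod 𝓘(ℝ, F)) B.frameMap (x₀, B.coord x₀ a) : EM × F →L[ℝ] EM × F)
      ((mfderiv (I.prod 𝓘(ℝ, F)) I (TotalSpace.proj : TotalSpace F E → M) ⟨x₀, a⟩ :
          EM × F →L[ℝ] EM) v,
        (mfderiv (I.prod 𝓘(ℝ, F)) 𝓘(ℝ, F) (fun q : TotalSpace F E => B.coord q.proj q.2) ⟨x₀, a⟩ :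
          EM × F →L[ℝ] F) v)
      = v := by
  have h1 : MDifferentiableAt (I.prod 𝓘(ℝ, F)) I (TotalSpace.proj : TotalSpace F E → M)
      ⟨x₀, a⟩ := (contMDiff_proj (n := ∞) E).mdifferentiableAt (by simp)
  have h2 := B.coord_smooth.mdifferentiableAt (x := ⟨x₀, a⟩) (by simp)
  have h3 := B.frame_smooth.mdifferentiableAt (x := (x₀, B.coord x₀ a)) (by simp)
  have h4 := B.contMDiff_coordMap.mdifferentiableAt (x := ⟨x₀, a⟩) (by simp)
  have hp := mfderiv_prodMk h1 h2
  have hc := mfderiv_comp (⟨x₀, a⟩ : TotalSpace F E) h3 h4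
  have hid : mfderiv (I.prod 𝓘(ℝ, F)) (I.prod 𝓘(ℝ, F)) (B.frameMap ∘ B.coordMap) ⟨x₀, a⟩
      = ContinuousLinearMap.id ℝ (EM × F) := by
    have he : B.frameMap ∘ B.coordMap =ᶠ[𝓝 (⟨x₀, a⟩ : TotalSpace F E)] id := by
      filter_upwards [B.eventually_bump_proj a] with q hq
      exact B.frameMap_coordMap hq
    exact he.mfderiv_eq.trans mfderiv_id
  have := DFunLike.congr_fun (hc.symm.trans hid) v
  refine Eq.trans ?_ this
  exact congrArg (mfderiv (I.prod 𝓘(ℝ, F)) (I.prod 𝓘(ℝ, F)) B.frameMap (x₀, B.coord x₀ a)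
    : EM × F →L[ℝ] EM × F) (DFunLike.congr_fun hp v).symm

/-- The frame carries a straight line in the fibre F to the curve that defines the vertical vector.
-/
theorem mfderiv_frameMap_vertical (a : E x₀) (u : F) :
    (mfderiv (I.prod 𝓘(ℝ, F)) (I.prod 𝓘(ℝ, F)) B.frameMap (x₀, B.coord x₀ a) :
      EM × F →L[ℝ] EM × F) (0, u)
      = verticalVec (I := I) (⟨x₀, a⟩ : TotalSpace F E) (B.frame x₀ u) := by
  set l : ℝ → F := fun t => B.coord x₀ a + t • u with hl
  have hfun : (fun t : ℝ => (⟨x₀, a + t • B.frame x₀ u⟩ : TotalSpace F E))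
      = B.frameMap ∘ fun t => (x₀, l t) := by
    funext t
    simp [frameMap, hl, B.frame_coord_self]
  have hl' : HasDerivAt l u 0 := by
    have h0 := ((hasDerivAt_id (0 : ℝ)).smul_const u).const_add (B.coord x₀ a)
    rwa [one_smul] at h0
  have hl0 : l 0 = B.coord x₀ a := by simp [hl]
  have h3 : HasMFDerivAt (I.prod 𝓘(ℝ, F)) (I.prod 𝓘(ℝ, F)) B.frameMap (x₀, l 0)
      (mfderiv (I.prod 𝓘(ℝ, F)) (I.prod 𝓘(ℝ, F)) B.frameMap (x₀, l 0)) :=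
    (B.frame_smooth.mdifferentiableAt (by simp)).hasMFDerivAt
  have h4 := (hasMFDerivAt_const (I := 𝓘(ℝ, ℝ)) (I' := I) x₀ (0 : ℝ)).prodMk
    hl'.hasFDerivAt.hasMFDerivAt
  have h := (h3.comp 0 h4).mfderiv
  unfold verticalVec
  dsimp only
  rw [hfun, h, ← hl0]
  show _ = (mfderiv (I.prod 𝓘(ℝ, F)) (I.prod 𝓘(ℝ, F)) B.frameMap (x₀, l 0) : EM × F →L[ℝ] EM × F)
    (0, (1 : ℝ) • u)
  rw [one_smul]

end BumpFrame

theorem exists_sec_eq (x₀ : M) (v : E x₀) : ∃ s : Sec I F E, s x₀ = v := by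
  obtain ⟨B⟩ := nonempty_bumpFrame (I := I) (F := F) (E := E) x₀
  exact ⟨B.sec (B.coord x₀ v), B.frame_coord_self v⟩

/-- Tangent vectors of the total space are separated by the functions on the base and the
fibrewise linear functions. -/
theorem eq_zero_of_forall_dAt_proj_hat {q : TotalSpace F E}
    {v : TangentSpace (I.prod 𝓘(ℝ, F)) q}
    (h : tangentProj I q v = 0)
    (h' : ∀ μ : DualSec I F E, dAt (I.prod 𝓘(ℝ, F)) μ.hat q v = 0) : v = 0 := by
  obtain ⟨x, a⟩ := q
  obtain ⟨B⟩ := nonempty_bumpFrame (I := I) (F := F) (E := E) x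
  have h2 := B.coord_smooth.mdifferentiableAt (x := ⟨x, a⟩) (by simp)
  have hw : (mfderiv (I.prod 𝓘(ℝ, F)) 𝓘(ℝ, F) (fun q : TotalSpace F E => B.coord q.proj q.2) ⟨x, a⟩ :
          EM × F →L[ℝ] F) v = 0 := by
    -- A linear form composed with the fibre coordinates is the fibrewise linear function of
    -- `B.dualSec l`, so `h'` applies to it.
    refine SeparatingDual.eq_zero_of_forall_dual_eq_zero (R := ℝ) (V := F) fun l => ?_
    have h3 := h' (B.dualSec l)
    have h4 := dAt_comp (f := l) (φ := fun q : TotalSpace F E => B.coord q.proj q.2)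
      (l.contMDiff.mdifferentiableAt (n := ∞) (by simp)) h2 v
    have h5 : mfderiv 𝓘(ℝ, F) 𝓘(ℝ, ℝ) l (B.coord x a) = l := by
      rw [mfderiv_eq_fderiv]; exact l.fderiv
    have h6 := h4.symm.trans h3
    have h7 : (mfderiv 𝓘(ℝ, F) 𝓘(ℝ, ℝ) l (B.coord x a) : F →L[ℝ] ℝ)
      ((mfderiv (I.prod 𝓘(ℝ, F)) 𝓘(ℝ, F) (fun q : TotalSpace F E => B.coord q.proj q.2) ⟨x, a⟩ :
          EM × F →L[ℝ] F) v) = 0 := h6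
    rw [h5] at h7
    exact h7
  have h1 := B.mfderiv_frameMap_mfderiv_coordMap a v
  rw [← h1, hw]
  have h0 : (mfderiv (I.prod 𝓘(ℝ, F)) I (TotalSpace.proj : TotalSpace F E → M) ⟨x, a⟩ :
          EM × F →L[ℝ] EM) v = 0 := h
  rw [h0]
  exact map_zero _

/-- A vector tangent to a fibre is the vertical lift of a point of the fibre. -/
theorem exists_verticalVec_eq {q : TotalSpace F E} {v : TangentSpace (I.prod 𝓘(ℝ, F)) q}
    (h : tangentProj I q v = 0) : ∃ b : E q.proj, verticalVec (I := I) q b = v := by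
  obtain ⟨x, a⟩ := q
  obtain ⟨B⟩ := nonempty_bumpFrame (I := I) (F := F) (E := E) x
  have h1 := B.mfderiv_frameMap_mfderiv_coordMap a v
  have h0 : (mfderiv (I.prod 𝓘(ℝ, F)) I (TotalSpace.proj : TotalSpace F E → M) ⟨x, a⟩ :
          EM × F →L[ℝ] EM) v = 0 := h
  rw [h0] at h1
  exact ⟨_, (B.mfderiv_frameMap_vertical a _).symm.trans h1⟩

/-- A linear map on sections that vanishes on the sections `f η` with `f(x₀) = 0` depends only on
the value of the section at `x₀`. -/
theorem map_eq_zero_of_apply_eq_zero [FiniteDimensional ℝ F] {x₀ : M} (T : Sec I F E →ₗ[ℝ] ℝ)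
    (hT : ∀ (f : C^∞⟮I, M; 𝓘(ℝ, ℝ), ℝ⟯) (η : Sec I F E), f x₀ = 0 → T (smulSec f η) = 0)
    {η : Sec I F E} (hη : η x₀ = 0) : T η = 0 := by
  obtain ⟨B⟩ := nonempty_bumpFrame (I := I) (F := F) (E := E) x₀
  let b := Module.finBasis ℝ F
  let f : Fin (Module.finrank ℝ F) → C^∞⟮I, M; 𝓘(ℝ, ℝ), ℝ⟯ := fun j =>
    ⟨fun x => LinearMap.toContinuousLinearMap (b.coord j) (B.coord x (η x)),
      (LinearMap.toContinuousLinearMap (b.coord j)).contMDiff.comp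
        (B.coord_smooth.comp η.contMDiff)⟩
  let g : C^∞⟮I, M; 𝓘(ℝ, ℝ), ℝ⟯ := ⟨fun x => 1 - B.bump x, contMDiff_const.sub B.bump.contMDiff⟩
  -- The frame expansion equals bump · η; the remainder (1 - bump) η makes the identity global. All
  -- the coefficients, including 1 - bump, vanish at x₀.
  have hdec : η = smulSec g η + ∑ j, smulSec (f j) (B.sec (b j)) := by
    ext x
    have hs : (∑ j, smulSec (f j) (B.sec (b j))) x = ∑ j, smulSec (f j) (B.sec (b j)) x := by
      rw [← ContMDiffSection.coeAddHom_apply, map_sum, Finset.sum_apply]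
      rfl
    rw [ContMDiffSection.coe_add, Pi.add_apply, hs]
    have h2 : ∑ j, smulSec (f j) (B.sec (b j)) x = B.bump x • η x := by
      rw [← B.frame_coord]
      conv_rhs => rw [← b.sum_repr (B.coord x (η x)), map_sum]
      refine Finset.sum_congr rfl fun j _ => ?_
      rw [map_smul]
      rfl
    rw [h2]
    show η x = (1 - B.bump x) • η x + B.bump x • η x
    rw [← add_smul, sub_add_cancel, one_smul]
  rw [hdec, map_add, map_sum, hT, Finset.sum_eq_zero, add_zero]
  · intro j _
    refine hT _ _ ?_
    show b.coord j (B.coord x₀ (η x₀)) = 0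
    rw [hη, map_zero, map_zero]
  · show 1 - B.bump x₀ = 0
    rw [B.bump_eq_one.self_of_nhds, sub_self]

end Frames

/-! ### Vertical vectors, their action on functions, and their smoothness. -/

section VerticalLifts

variable {EM : Type*} [NormedAddCommGroup EM] [NormedSpace ℝ EM] [FiniteDimensional ℝ EM]
  {H : Type*} [TopologicalSpace H] {I : ModelWithCorners ℝ EM H}
  {M : Type*} [TopologicalSpace M] [T2Space M] [ChartedSpace H M] [IsManifold I ∞ M]
  {F : Type*} [NormedAddCommGroup F] [NormedSpace ℝ F]
  {E : M → Type*} [TopologicalSpace (TotalSpace F E)]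
  [∀ x, AddCommGroup (E x)] [∀ x, Module ℝ (E x)] [∀ x, TopologicalSpace (E x)]
  [FiberBundle F E] [VectorBundle ℝ F E] [ContMDiffVectorBundle ∞ F E I]

theorem dAt_comp_proj {f : M → ℝ} {q : TotalSpace F E} (hf : MDifferentiableAt I 𝓘(ℝ, ℝ) f q.proj)
    (v : TangentSpace (I.prod 𝓘(ℝ, F)) q) :
    dAt (I.prod 𝓘(ℝ, F)) (fun p : TotalSpace F E => f p.proj) q v
      = dAt I f q.proj (tangentProj I q v) :=
  dAt_comp hf ((contMDiff_proj (n := ∞) E).mdifferentiableAt (by simp)) v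

/-- The vertical vector is the velocity of a line in the fibre, so only the slope of f along that
line matters. -/
theorem dAt_verticalVec_of_forall_add {f : TotalSpace F E → ℝ} {q : TotalSpace F E}
    (hf : MDifferentiableAt (I.prod 𝓘(ℝ, F)) 𝓘(ℝ, ℝ) f q) (b : E q.proj) (c : ℝ)
    (h : ∀ t : ℝ, f ⟨q.proj, q.2 + t • b⟩ = f q + t * c) :
    dAt (I.prod 𝓘(ℝ, F)) f q (verticalVec (I := I) q b) = c := by
  obtain ⟨B⟩ := nonempty_bumpFrame (I := I) (F := F) (E := E) q.proj
  have hcurve : MDifferentiableAt 𝓘(ℝ, ℝ) (I.prod 𝓘(ℝ, F))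
      (fun t : ℝ => (⟨q.proj, q.2 + t • b⟩ : TotalSpace F E)) 0 := by
    have hfun : (fun t : ℝ => (⟨q.proj, q.2 + t • b⟩ : TotalSpace F E))
        = fun t : ℝ => B.frameMap (q.proj, B.coord q.proj q.2 + t • B.coord q.proj b) := by
      funext t
      simp [BumpFrame.frameMap, B.frame_coord_self]
    rw [hfun]
    have h1 : ContMDiff 𝓘(ℝ, ℝ) 𝓘(ℝ, F) ∞
        (fun t : ℝ => B.coord q.proj q.2 + t • B.coord q.proj b) :=
      (contDiff_const.add (contDiff_id.smul contDiff_const)).contMDiff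
    exact (B.frame_smooth.comp (contMDiff_const.prodMk h1)).mdifferentiableAt (by simp)
  have h0 : (⟨q.proj, q.2 + (0 : ℝ) • b⟩ : TotalSpace F E) = q := by
    rw [zero_smul, add_zero]
  have hf' : MDifferentiableAt (I.prod 𝓘(ℝ, F)) 𝓘(ℝ, ℝ) f ⟨q.proj, q.2 + (0 : ℝ) • b⟩ := by
    rwa [h0]
  have h2 := mfderiv_comp (0 : ℝ) hf' hcurve
  have h3 : f ∘ (fun t : ℝ => (⟨q.proj, q.2 + t • b⟩ : TotalSpace F E))
      = fun t : ℝ => f q + t * c := funext h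
  rw [h3, mfderiv_eq_fderiv] at h2
  have h4 : HasDerivAt (fun t : ℝ => f q + t * c) c 0 := by
    have := ((hasDerivAt_id (0 : ℝ)).mul_const c).const_add (f q)
    rwa [one_mul] at this
  have h5 : (fderiv ℝ (fun t : ℝ => f q + t * c) 0 : ℝ →L[ℝ] ℝ) 1 = c := by
    rw [h4.hasFDerivAt.fderiv]
    simp
  have h6 := DFunLike.congr_fun h2 (1 : ℝ)
  -- The curve starts at q + 0 • b, which is q only propositionally; this transports the derivative
  -- between the two base points.
  have h7 : ∀ q' : TotalSpace F E, q' = q → ∀ w : EM × F,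
      (mfderiv (I.prod 𝓘(ℝ, F)) 𝓘(ℝ, ℝ) f q' : EM × F →L[ℝ] ℝ) w
        = (mfderiv (I.prod 𝓘(ℝ, F)) 𝓘(ℝ, ℝ) f q : EM × F →L[ℝ] ℝ) w := by
    rintro _ rfl w
    rfl
  exact ((h7 _ h0 _).symm.trans h6.symm).trans h5

theorem DualSec.contMDiff_hat (μ : DualSec I F E) :
    ContMDiff (I.prod 𝓘(ℝ, F)) 𝓘(ℝ, ℝ) ∞ μ.hat := μ.smooth

theorem DualSec.dAt_hat_verticalVec (μ : DualSec I F E) (q : TotalSpace F E) (b : E q.proj) :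
    dAt (I.prod 𝓘(ℝ, F)) μ.hat q (verticalVec (I := I) q b) = μ.toFun q.proj b :=
  dAt_verticalVec_of_forall_add (μ.smooth.mdifferentiableAt (by simp)) b _ fun t => by
    simp

/-- In a trivialization this is addition and scaling in F. Its time derivative at 0 is the vertical
field of V. -/
theorem contMDiff_add_smul {V : ∀ q : TotalSpace F E, E q.proj}
    (hV : ContMDiff (I.prod 𝓘(ℝ, F)) (I.prod 𝓘(ℝ, F)) ∞
      (fun q : TotalSpace F E => (⟨q.proj, V q⟩ : TotalSpace F E))) :
    ContMDiff (𝓘(ℝ, ℝ).prod (I.prod 𝓘(ℝ, F))) (I.prod 𝓘(ℝ, F)) ∞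
      (fun p : ℝ × TotalSpace F E => (⟨p.2.proj, p.2.2 + p.1 • V p.2⟩ : TotalSpace F E)) := by
  intro p
  set e := trivializationAt F E p.2.proj
  have hp : p.2.proj ∈ e.baseSet := FiberBundle.mem_baseSet_trivializationAt F E p.2.proj
  have hproj : ContMDiff (𝓘(ℝ, ℝ).prod (I.prod 𝓘(ℝ, F))) I ∞
      (fun p : ℝ × TotalSpace F E => p.2.proj) := (contMDiff_proj E).comp contMDiff_snd
  have h1 : ContMDiffAt (𝓘(ℝ, ℝ).prod (I.prod 𝓘(ℝ, F))) (I.prod 𝓘(ℝ, F)) ∞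
      (fun p : ℝ × TotalSpace F E => p.2) p := contMDiffAt_snd
  have h2 : ContMDiffAt (𝓘(ℝ, ℝ).prod (I.prod 𝓘(ℝ, F))) (I.prod 𝓘(ℝ, F)) ∞
      (fun p : ℝ × TotalSpace F E => (⟨p.2.proj, V p.2⟩ : TotalSpace F E)) p :=
    (hV.comp contMDiff_snd).contMDiffAt
  rw [e.contMDiffAt_iff (by rw [Trivialization.mem_source]; exact hp)] at h1 h2 ⊢
  refine ⟨hproj.contMDiffAt, ?_⟩
  have h3 : ContMDiffAt (𝓘(ℝ, ℝ).prod (I.prod 𝓘(ℝ, F))) 𝓘(ℝ, ℝ) ∞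
      (fun p : ℝ × TotalSpace F E => p.1) p := contMDiffAt_fst
  refine (h1.2.add (h3.smul h2.2)).congr_of_eventuallyEq ?_
  filter_upwards [hproj.continuous.continuousAt.preimage_mem_nhds (e.open_baseSet.mem_nhds hp)]
    with r hr
  have h4 := e.coe_linearMapAt_of_mem (R := ℝ) hr
  have h5 : ∀ v : E r.2.proj, (e ⟨r.2.proj, v⟩).2 = e.linearMapAt ℝ r.2.proj v := fun v => by
    rw [h4]
  show (e ⟨r.2.proj, r.2.2 + r.1 • V r.2⟩).2
    = (e ⟨r.2.proj, r.2.2⟩).2 + r.1 • (e ⟨r.2.proj, V r.2⟩).2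
  rw [h5, h5, h5, map_add, map_smul]

/-- The vertical vector field of a smooth map `E → E` over the identity of `M` is smooth. -/
theorem contMDiff_verticalVec {V : ∀ q : TotalSpace F E, E q.proj}
    (hV : ContMDiff (I.prod 𝓘(ℝ, F)) (I.prod 𝓘(ℝ, F)) ∞
      (fun q : TotalSpace F E => (⟨q.proj, V q⟩ : TotalSpace F E))) :
    ContMDiff (I.prod 𝓘(ℝ, F)) (I.prod 𝓘(ℝ, F)).tangent ∞
      (fun q : TotalSpace F E => (⟨q, verticalVec (I := I) q (V q)⟩ :
        TangentBundle (I.prod 𝓘(ℝ, F)) (TotalSpace F E))) := by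
  set m : ℝ × TotalSpace F E → TotalSpace F E :=
    fun p => ⟨p.2.proj, p.2.2 + p.1 • V p.2⟩ with hm
  have hms := contMDiff_add_smul hV
  have h1 : IsManifold (I.prod 𝓘(ℝ, F)) 1 (TotalSpace F E) := IsManifold.of_le (n := ∞) (by simp)
  have h2 : ContMDiff (I.prod 𝓘(ℝ, F)) 𝓘(ℝ, ℝ).tangent ∞
      (fun _ : TotalSpace F E => (⟨(0 : ℝ), (1 : ℝ)⟩ : TangentBundle 𝓘(ℝ, ℝ) ℝ)) :=
    contMDiff_const
  have h3 : ContMDiff (I.prod 𝓘(ℝ, F)) (I.prod 𝓘(ℝ, F)).tangent ∞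
      (zeroSection (EM × F) (TangentSpace (I.prod 𝓘(ℝ, F)) : TotalSpace F E → Type _)) :=
    contMDiff_zeroSection ℝ _
  -- The vertical field at q is the image under the tangent map of m of the vector (1, 0) at (0, q).
  have h4 := (hms.contMDiff_tangentMap (m := ∞) (by simp)).comp
    (contMDiff_equivTangentBundleProd_symm.comp (h2.prodMk h3))
  have h5 : ∀ p p' : TotalSpace F E, p' = p → ∀ w : EM × F,
      (⟨p, w⟩ : TangentBundle (I.prod 𝓘(ℝ, F)) (TotalSpace F E)) = ⟨p', w⟩ := by
    rintro p _ rfl w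
    rfl
  refine h4.congr fun q => ?_
  have h6 : m (0, q) = q := by
    simp [hm]
  refine (congrArg _ ?_).trans (h5 q (m (0, q)) h6
    ((mfderiv (𝓘(ℝ, ℝ).prod (I.prod 𝓘(ℝ, F))) (I.prod 𝓘(ℝ, F)) m (0, q) :
      ℝ × (EM × F) →L[ℝ] EM × F) (1, 0)))
  have h7 : HasMFDerivAt 𝓘(ℝ, ℝ) (𝓘(ℝ, ℝ).prod (I.prod 𝓘(ℝ, F))) (fun t : ℝ => (t, q)) 0
      _ := (hasMFDerivAt_id (0 : ℝ)).prodMk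
        (hasMFDerivAt_const (I := 𝓘(ℝ, ℝ)) (I' := I.prod 𝓘(ℝ, F)) q (0 : ℝ))
  have h8 := ((hms.mdifferentiableAt (x := (0, q)) (by simp)).hasMFDerivAt.comp (0 : ℝ) h7).mfderiv
  exact DFunLike.congr_fun h8 (1 : ℝ)

/-- The derivative of `L` along the vertical lift of a section. -/
def vertDeriv (L : TotalSpace F E → ℝ) (σ : Sec I F E) (q : TotalSpace F E) : ℝ :=
  dAt (I.prod 𝓘(ℝ, F)) L q (verticalVec (I := I) q (σ q.proj))

theorem contMDiff_verticalVec_sec (σ : Sec I F E) :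
    ContMDiff (I.prod 𝓘(ℝ, F)) (I.prod 𝓘(ℝ, F)).tangent ∞
      (fun q : TotalSpace F E => (⟨q, verticalVec (I := I) q (σ q.proj)⟩ :
        TangentBundle (I.prod 𝓘(ℝ, F)) (TotalSpace F E))) :=
  contMDiff_verticalVec (V := fun q => σ q.proj) (σ.contMDiff.comp (contMDiff_proj E))

theorem contMDiff_vertDeriv {L : TotalSpace F E → ℝ}
    (hL : ContMDiff (I.prod 𝓘(ℝ, F)) 𝓘(ℝ, ℝ) ∞ L) (σ : Sec I F E) :
    ContMDiff (I.prod 𝓘(ℝ, F)) 𝓘(ℝ, ℝ) ∞ (vertDeriv L σ) :=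
  contMDiff_dAt hL (contMDiff_verticalVec_sec σ)

theorem vertDeriv_add (L : TotalSpace F E → ℝ) (σ η : Sec I F E) (q : TotalSpace F E) :
    vertDeriv L (σ + η) q = vertDeriv L σ q + vertDeriv L η q := by
  unfold vertDeriv
  rw [← map_add, ← (verticalVec_linear q).map_add]
  rfl

theorem vertDeriv_smul (L : TotalSpace F E → ℝ) (c : ℝ) (σ : Sec I F E) (q : TotalSpace F E) :
    vertDeriv L (c • σ) q = c * vertDeriv L σ q := by
  unfold vertDeriv
  rw [← smul_eq_mul, ← map_smul, ← (verticalVec_linear q).map_smul]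
  rfl

theorem dAt_vertDeriv_add {L : TotalSpace F E → ℝ}
    (hL : ContMDiff (I.prod 𝓘(ℝ, F)) 𝓘(ℝ, ℝ) ∞ L) (σ η : Sec I F E) (q : TotalSpace F E)
    (v : TangentSpace (I.prod 𝓘(ℝ, F)) q) :
    dAt (I.prod 𝓘(ℝ, F)) (vertDeriv L (σ + η)) q v
      = dAt (I.prod 𝓘(ℝ, F)) (vertDeriv L σ) q v + dAt (I.prod 𝓘(ℝ, F)) (vertDeriv L η) q v := by
  have h : vertDeriv L (σ + η) = fun q => vertDeriv L σ q + vertDeriv L η q :=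
    funext fun q => vertDeriv_add L σ η q
  rw [h, dAt_add ((contMDiff_vertDeriv hL σ).mdifferentiableAt (by simp))
    ((contMDiff_vertDeriv hL η).mdifferentiableAt (by simp))]

theorem dAt_vertDeriv_smul {L : TotalSpace F E → ℝ}
    (hL : ContMDiff (I.prod 𝓘(ℝ, F)) 𝓘(ℝ, ℝ) ∞ L) (c : ℝ) (σ : Sec I F E) (q : TotalSpace F E)
    (v : TangentSpace (I.prod 𝓘(ℝ, F)) q) :
    dAt (I.prod 𝓘(ℝ, F)) (vertDeriv L (c • σ)) q v
      = c * dAt (I.prod 𝓘(ℝ, F)) (vertDeriv L σ) q v := by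
  have h : vertDeriv L (c • σ) = fun q => c * vertDeriv L σ q :=
    funext fun q => vertDeriv_smul L c σ q
  rw [h, dAt_mul (f := fun _ => c) (contMDiff_const.mdifferentiableAt (n := ∞) (by simp))
    ((contMDiff_vertDeriv hL σ).mdifferentiableAt (by simp)), dAt_const]
  ring

end VerticalLifts

/-! ### Existence, uniqueness and smoothness of complete lifts. -/

section CompleteLifts

variable {EM : Type*} [NormedAddCommGroup EM] [NormedSpace ℝ EM] [FiniteDimensional ℝ EM]
  {H : Type*} [TopologicalSpace H] {I : ModelWithCorners ℝ EM H}
  {M : Type*} [TopologicalSpace M] [T2Space M] [ChartedSpace H M] [IsManifold I ∞ M]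
  {F : Type*} [NormedAddCommGroup F] [NormedSpace ℝ F]
  {E : M → Type*} [TopologicalSpace (TotalSpace F E)]
  [∀ x, AddCommGroup (E x)] [∀ x, Module ℝ (E x)] [∀ x, TopologicalSpace (E x)]
  [FiberBundle F E] [VectorBundle ℝ F E] [ContMDiffVectorBundle ∞ F E I]

theorem LieAlgebroid.bracket_swap (A : LieAlgebroid I F E) (σ η : Sec I F E) :
    A.bracket η σ = -A.bracket σ η := by
  have h := A.bracket_self (σ + η)
  rw [map_add, map_add, LinearMap.add_apply, LinearMap.add_apply, A.bracket_self,
    A.bracket_self, zero_add, add_zero] at h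
  exact eq_neg_of_add_eq_zero_left h

theorem DualSec.contMDiff_apply (μ : DualSec I F E) (η : Sec I F E) :
    ContMDiff I 𝓘(ℝ, ℝ) ∞ (fun x => μ.toFun x (η x)) :=
  μ.smooth.comp η.contMDiff

/-- The Lie derivative of a section of `E*` at a point, as a linear form on sections of `E`. -/
def LieAlgebroid.lieDerivAt (A : LieAlgebroid I F E) (σ : Sec I F E) (μ : DualSec I F E) (x : M) :
    Sec I F E →ₗ[ℝ] ℝ where
  toFun η := A.lieDeriv σ μ η x
  map_add' η ζ := by
    unfold LieAlgebroid.lieDeriv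
    have h : (fun y => μ.toFun y ((η + ζ) y)) = fun y => μ.toFun y (η y) + μ.toFun y (ζ y) :=
      funext fun y => map_add _ _ _
    rw [h, dAt_add ((μ.contMDiff_apply η).mdifferentiableAt (by simp))
      ((μ.contMDiff_apply ζ).mdifferentiableAt (by simp)), map_add, ContMDiffSection.coe_add,
      Pi.add_apply, map_add]
    ring
  map_smul' c η := by
    unfold LieAlgebroid.lieDeriv
    have h : (fun y => μ.toFun y ((c • η) y)) = fun y => c * μ.toFun y (η y) :=
      funext fun y => map_smul _ _ _
    rw [h, dAt_mul (f := fun _ => c) (contMDiff_const.mdifferentiableAt (n := ∞) (by simp))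
      ((μ.contMDiff_apply η).mdifferentiableAt (by simp)), map_smul, ContMDiffSection.coe_smul,
      Pi.smul_apply, map_smul, dAt_const, smul_eq_mul, smul_eq_mul, RingHom.id_apply]
    ring

/-- Tensoriality: for a section f θ the term (ρ(σ)f)⟨μ, θ⟩ comes once from differentiating the
pairing and once from the Leibniz rule, with opposite signs. This makes the condition defining the
complete lift independent of the auxiliary section. -/
theorem LieAlgebroid.lieDeriv_congr [FiniteDimensional ℝ F] (A : LieAlgebroid I F E)
    (σ : Sec I F E) (μ : DualSec I F E) {η ζ : Sec I F E} {x : M} (h : η x = ζ x) :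
    A.lieDeriv σ μ η x = A.lieDeriv σ μ ζ x := by
  have h0 : A.lieDerivAt σ μ x (η - ζ) = 0 := by
    refine map_eq_zero_of_apply_eq_zero (x₀ := x) _ ?_ ?_
    · intro f θ hf
      show dAt I (fun y => μ.toFun y (f y • θ y)) x (A.anchor.toFun x (σ x))
        - μ.toFun x (A.bracket σ (smulSec f θ) x) = 0
      have hm : (fun y => μ.toFun y (f y • θ y)) = fun y => f y * μ.toFun y (θ y) :=
        funext fun y => map_smul _ _ _
      rw [A.leibniz, hm, dAt_mul (f.contMDiff.mdifferentiableAt (by simp))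
        ((μ.contMDiff_apply θ).mdifferentiableAt (by simp)), hf, map_add, map_smul, map_smul,
        smul_eq_mul, smul_eq_mul]
      ring
    · rw [ContMDiffSection.coe_sub, Pi.sub_apply, h, sub_self]
  rw [map_sub, sub_eq_zero] at h0
  exact h0

/-- The value of the complete lift of `σ` at `η(x)`, computed with the section `η`. -/
def completeLiftVec (A : LieAlgebroid I F E) (σ η : Sec I F E) (x : M) :
    TangentSpace (I.prod 𝓘(ℝ, F)) (⟨x, η x⟩ : TotalSpace F E) :=
  (mfderiv I (I.prod 𝓘(ℝ, F)) (fun y => (⟨y, η y⟩ : TotalSpace F E)) x : EM →L[ℝ] EM × F)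
      (A.anchor.toFun x (σ x))
    - (verticalVec (I := I) (⟨x, η x⟩ : TotalSpace F E) (A.bracket σ η x) : EM × F)

theorem tangentProj_mfderiv_sec (η : Sec I F E) (x : M) (v : TangentSpace I x) :
    tangentProj I (⟨x, η x⟩ : TotalSpace F E)
      (mfderiv I (I.prod 𝓘(ℝ, F)) (fun y => (⟨y, η y⟩ : TotalSpace F E)) x v) = v := by
  have h1 : MDifferentiableAt (I.prod 𝓘(ℝ, F)) I (TotalSpace.proj : TotalSpace F E → M)
      ⟨x, η x⟩ := (contMDiff_proj (n := ∞) E).mdifferentiableAt (by simp)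
  have h2 := mfderiv_comp x h1 (η.contMDiff.mdifferentiableAt (by simp))
  have h3 : mfderiv I I ((TotalSpace.proj : TotalSpace F E → M) ∘
      fun y => (⟨y, η y⟩ : TotalSpace F E)) x = ContinuousLinearMap.id ℝ _ := mfderiv_id
  exact (DFunLike.congr_fun (h2.symm.trans h3) v)

theorem tangentProj_completeLiftVec (A : LieAlgebroid I F E) (σ η : Sec I F E) (x : M) :
    tangentProj I (⟨x, η x⟩ : TotalSpace F E) (completeLiftVec A σ η x)
      = A.anchor.toFun x (σ x) := by
  refine (map_sub (tangentProj I (⟨x, η x⟩ : TotalSpace F E)) _ _).trans ?_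
  rw [tangentProj_verticalVec, sub_zero]
  exact tangentProj_mfderiv_sec η x _

theorem dAt_hat_completeLiftVec (A : LieAlgebroid I F E) (σ η : Sec I F E) (x : M)
    (μ : DualSec I F E) :
    dAt (I.prod 𝓘(ℝ, F)) μ.hat (⟨x, η x⟩ : TotalSpace F E) (completeLiftVec A σ η x)
      = A.lieDeriv σ μ η x := by
  refine (map_sub (dAt (I.prod 𝓘(ℝ, F)) μ.hat (⟨x, η x⟩ : TotalSpace F E)) _ _).trans ?_
  rw [μ.dAt_hat_verticalVec]
  unfold LieAlgebroid.lieDeriv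
  congr 1
  exact (dAt_comp (f := μ.hat) (φ := fun y => (⟨y, η y⟩ : TotalSpace F E))
    (μ.smooth.mdifferentiableAt (by simp)) (η.contMDiff.mdifferentiableAt (by simp)) _).symm

/-- The vector Tη(ρ(σ)) - [σ, η]^V acts on μ̂ by the two terms of the Lie derivative computed with
η; tensoriality passes to every other section through the point. -/
theorem isCompleteLiftAt_completeLiftVec [FiniteDimensional ℝ F] (A : LieAlgebroid I F E)
    (σ η : Sec I F E) (x : M) :
    IsCompleteLiftAt A σ (⟨x, η x⟩ : TotalSpace F E)
      ⟨(σ x, completeLiftVec A σ η x), (tangentProj_completeLiftVec A σ η x).symm⟩ := by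
  refine ⟨rfl, fun μ ζ hζ => ?_⟩
  exact (dAt_hat_completeLiftVec A σ η x μ).trans (A.lieDeriv_congr σ μ hζ.symm)

/-- Equal components in E make the difference of the tangent components vertical, and fibrewise
linear functions do not see it. -/
theorem IsCompleteLiftAt.unique (A : LieAlgebroid I F E) (σ : Sec I F E)
    {a : TotalSpace F E} {z w : Prol A.anchor a} (hz : IsCompleteLiftAt A σ a z)
    (hw : IsCompleteLiftAt A σ a w) : z = w := by
  have h1 : z.1.1 = w.1.1 := hz.1.trans hw.1.symm
  have h2 : z.1.2 - w.1.2 = 0 := by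
    refine eq_zero_of_forall_dAt_proj_hat ?_ fun μ => ?_
    · have hz' : A.anchor.toFun a.proj z.1.1 = tangentProj I a z.1.2 := z.2
      have hw' : A.anchor.toFun a.proj w.1.1 = tangentProj I a w.1.2 := w.2
      rw [map_sub, ← hz', ← hw', h1, sub_self]
    · obtain ⟨η, hη⟩ := exists_sec_eq (I := I) (F := F) a.proj a.2
      rw [map_sub, sub_eq_zero]
      exact (hz.2 μ η hη).trans (hw.2 μ η hη).symm
  exact Subtype.ext (Prod.ext h1 (sub_eq_zero.1 h2))

theorem isCompleteLiftAt_completeLift [FiniteDimensional ℝ F] (A : LieAlgebroid I F E)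
    (σ : Sec I F E) (a : TotalSpace F E) : IsCompleteLiftAt A σ a (completeLift A σ a) := by
  refine Classical.epsilon_spec (p := IsCompleteLiftAt A σ a) ?_
  obtain ⟨x, v⟩ := a
  obtain ⟨η, rfl⟩ := exists_sec_eq (I := I) (F := F) x v
  exact ⟨_, isCompleteLiftAt_completeLiftVec A σ η x⟩

/-- The vector field on `E` of the complete lift. -/
def completeLiftField (A : LieAlgebroid I F E) (σ : Sec I F E) (a : TotalSpace F E) :
    TangentSpace (I.prod 𝓘(ℝ, F)) a :=
  Prol.anchor A.anchor a (completeLift A σ a)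

section FiniteRank

variable [FiniteDimensional ℝ F]

theorem completeLift_fst (A : LieAlgebroid I F E) (σ : Sec I F E) (a : TotalSpace F E) :
    (completeLift A σ a).1.1 = σ a.proj :=
  (isCompleteLiftAt_completeLift A σ a).1

theorem tangentProj_completeLiftField (A : LieAlgebroid I F E) (σ : Sec I F E)
    (a : TotalSpace F E) :
    tangentProj I a (completeLiftField A σ a) = A.anchor.toFun a.proj (σ a.proj) := by
  rw [← completeLift_fst]
  exact (completeLift A σ a).2.symm

theorem dAt_hat_completeLiftField (A : LieAlgebroid I F E) (σ : Sec I F E)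
    (μ : DualSec I F E) {η : Sec I F E} {a : TotalSpace F E} (h : η a.proj = a.2) :
    dAt (I.prod 𝓘(ℝ, F)) μ.hat a (completeLiftField A σ a) = A.lieDeriv σ μ η a.proj :=
  (isCompleteLiftAt_completeLift A σ a).2 μ η h

/-- Frees the choice of the section through the point, so that one with constant coordinates can be
used for smoothness. -/
theorem completeLiftField_eq (A : LieAlgebroid I F E) (σ η : Sec I F E) (x : M) :
    completeLiftField A σ (⟨x, η x⟩ : TotalSpace F E) = completeLiftVec A σ η x := by
  have h := IsCompleteLiftAt.unique A σ (isCompleteLiftAt_completeLift A σ ⟨x, η x⟩)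
    (isCompleteLiftAt_completeLiftVec A σ η x)
  unfold completeLiftField
  rw [h]
  rfl

theorem BumpFrame.sec_eq_sum {x₀ : M} (B : BumpFrame I F E x₀) (y : F) :
    B.sec y = ∑ j, (Module.finBasis ℝ F).repr y j • B.sec (Module.finBasis ℝ F j) := by
  let S : F →ₗ[ℝ] Sec I F E :=
    { toFun := B.sec
      map_add' := fun y z => by ext x; exact map_add (B.frame x) _ _
      map_smul' := fun c y => by ext x; exact map_smul (B.frame x) _ _ }
  show S y = ∑ j, (Module.finBasis ℝ F).repr y j • S (Module.finBasis ℝ F j)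
  conv_lhs => rw [← (Module.finBasis ℝ F).sum_repr y, map_sum]
  exact Finset.sum_congr rfl fun j _ => map_smul _ _ _

/-- The horizontal part of a complete lift in a frame. -/
def BumpFrame.horVec {x₀ : M} (B : BumpFrame I F E x₀) (A : LieAlgebroid I F E) (σ : Sec I F E)
    (q : TotalSpace F E) : TangentSpace (I.prod 𝓘(ℝ, F)) q :=
  (mfderiv (I.prod 𝓘(ℝ, F)) (I.prod 𝓘(ℝ, F)) B.frameMap (B.coordMap q) : EM × F →L[ℝ] EM × F)
    (A.anchor.toFun q.proj (σ q.proj), (0 : F))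

/-- The horizontal part is the tangent map of the frame applied to the smooth field (ρ(σ), 0). That
image sits over frame(coord q), which is q only where the bump is 1, hence the local statement. -/
theorem BumpFrame.contMDiffAt_horVec {x₀ : M} (B : BumpFrame I F E x₀) (A : LieAlgebroid I F E)
    (σ : Sec I F E) (v : E x₀) :
    ContMDiffAt (I.prod 𝓘(ℝ, F)) (I.prod 𝓘(ℝ, F)).tangent ∞
      (fun q : TotalSpace F E => (⟨q, B.horVec A σ q⟩ :
        TangentBundle (I.prod 𝓘(ℝ, F)) (TotalSpace F E))) ⟨x₀, v⟩ := by
  have h0 : IsManifold I 1 M := IsManifold.of_le (n := ∞) (by simp)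
  have h1 : IsManifold (I.prod 𝓘(ℝ, F)) 1 (TotalSpace F E) := IsManifold.of_le (n := ∞) (by simp)
  have h2 : ContMDiff (I.prod 𝓘(ℝ, F)) I.tangent ∞
      (fun q : TotalSpace F E => (⟨q.proj, A.anchor.toFun q.proj (σ q.proj)⟩ :
        TangentBundle I M)) := A.anchor.smooth.comp (σ.contMDiff.comp (contMDiff_proj E))
  have h3 : ContMDiff (I.prod 𝓘(ℝ, F)) 𝓘(ℝ, F).tangent ∞
      (fun q : TotalSpace F E => (⟨B.coord q.proj q.2, (0 : F)⟩ : TangentBundle 𝓘(ℝ, F) F)) :=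
    (contMDiff_zeroSection ℝ (TangentSpace 𝓘(ℝ, F) : F → Type _)).comp B.coord_smooth
  have h4 := (B.frame_smooth.contMDiff_tangentMap (m := ∞) (by simp)).comp
    (contMDiff_equivTangentBundleProd_symm.comp (h2.prodMk h3))
  refine h4.contMDiffAt.congr_of_eventuallyEq ?_
  have h5 : ∀ p p' : TotalSpace F E, p' = p → ∀ w : EM × F,
      (⟨p, w⟩ : TangentBundle (I.prod 𝓘(ℝ, F)) (TotalSpace F E)) = ⟨p', w⟩ := by
    rintro p _ rfl w
    rfl
  filter_upwards [B.eventually_bump_proj v] with q hq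
  exact h5 q (B.frameMap (B.coordMap q)) (B.frameMap_coordMap hq) _

/-- Take the section through q with constant coordinates: its tangent map gives the horizontal part,
and its bracket with σ is linear in the coordinates of q, with fixed smooth sections as
coefficients. -/
theorem BumpFrame.completeLiftField_eq_horVec {x₀ : M} (B : BumpFrame I F E x₀)
    (A : LieAlgebroid I F E) (σ : Sec I F E) {q : TotalSpace F E} (hq : B.bump q.proj = 1) :
    completeLiftField A σ q = B.horVec A σ q - ∑ j, (Module.finBasis ℝ F).repr (B.coord q.proj q.2) j •
      verticalVec (I := I) q (A.bracket σ (B.sec (Module.finBasis ℝ F j)) q.proj) := by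
  obtain ⟨x, v⟩ := q
  have hv : B.sec (B.coord x v) x = v := by
    show B.frame x (B.coord x v) = v
    rw [B.frame_coord, hq, one_smul]
  have h1 : ∀ w : E x, w = v → B.sec (B.coord x v) x = w →
      completeLiftField A σ (⟨x, w⟩ : TotalSpace F E)
        = HSub.hSub (α := EM × F) (β := EM × F)
          ((mfderiv I (I.prod 𝓘(ℝ, F)) (fun y => (⟨y, B.sec (B.coord x v) y⟩ : TotalSpace F E)) x :
            EM →L[ℝ] EM × F) (A.anchor.toFun x (σ x)))
          (verticalVec (I := I) (⟨x, w⟩ : TotalSpace F E)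
            (A.bracket σ (B.sec (B.coord x v)) x)) := by
    rintro w - rfl
    exact completeLiftField_eq A σ _ x
  refine (h1 v rfl hv).trans (congrArg₂ (HSub.hSub (α := EM × F) (β := EM × F)) ?_ ?_)
  · have h2 := B.frame_smooth.mdifferentiableAt (x := (x, B.coord x v)) (by simp)
    have h3 : HasMFDerivAt I (I.prod 𝓘(ℝ, F)) (fun y : M => (y, B.coord x v)) x _ :=
      (hasMFDerivAt_id x).prodMk (hasMFDerivAt_const (I := I) (I' := 𝓘(ℝ, F)) (B.coord x v) x)
    exact DFunLike.congr_fun (h2.hasMFDerivAt.comp x h3).mfderiv _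
  · have h2 : A.bracket σ (B.sec (B.coord x v)) x
        = ∑ j, (Module.finBasis ℝ F).repr (B.coord x v) j •
          A.bracket σ (B.sec (Module.finBasis ℝ F j)) x := by
      conv_lhs => rw [B.sec_eq_sum, map_sum]
      rw [← ContMDiffSection.coeAddHom_apply, map_sum, Finset.sum_apply]
      refine Finset.sum_congr rfl fun j _ => ?_
      rw [map_smul]
      rfl
    rw [h2]
    refine (map_sum (verticalVec_linear (I := I) (⟨x, v⟩ : TotalSpace F E)).mk' _ _).trans ?_
    exact Finset.sum_congr rfl fun j _ => (verticalVec_linear _).map_smul _ _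

/-- The complete lift of a section is smooth. -/
theorem contMDiff_completeLiftField (A : LieAlgebroid I F E) (σ : Sec I F E) :
    ContMDiff (I.prod 𝓘(ℝ, F)) (I.prod 𝓘(ℝ, F)).tangent ∞
      (fun q : TotalSpace F E => (⟨q, completeLiftField A σ q⟩ :
        TangentBundle (I.prod 𝓘(ℝ, F)) (TotalSpace F E))) := by
  rintro ⟨x, v⟩
  have h1 : IsManifold (I.prod 𝓘(ℝ, F)) 1 (TotalSpace F E) := IsManifold.of_le (n := ∞) (by simp)
  obtain ⟨B⟩ := nonempty_bumpFrame (I := I) (F := F) (E := E) x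
  have h2 : ∀ j, ContMDiff (I.prod 𝓘(ℝ, F)) (I.prod 𝓘(ℝ, F)).tangent ∞
      (fun q : TotalSpace F E => (⟨q, (Module.finBasis ℝ F).repr (B.coord q.proj q.2) j •
        verticalVec (I := I) q (A.bracket σ (B.sec (Module.finBasis ℝ F j)) q.proj)⟩ :
        TangentBundle (I.prod 𝓘(ℝ, F)) (TotalSpace F E))) := fun j =>
    ContMDiff.smul_section
      ((LinearMap.toContinuousLinearMap ((Module.finBasis ℝ F).coord j)).contMDiff.comp
        B.coord_smooth)
      (contMDiff_verticalVec_sec (A.bracket σ (B.sec (Module.finBasis ℝ F j))))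
  have h3 := ContMDiff.sum_section (s := Finset.univ) fun j _ => h2 j
  have h4 := (B.contMDiffAt_horVec A σ v).sub_section h3.contMDiffAt
  refine h4.congr_of_eventuallyEq ?_
  filter_upwards [B.eventually_bump_proj v] with q hq
  rw [B.completeLiftField_eq_horVec A σ hq]
  rfl

end FiniteRank

end CompleteLifts

/-! ### The anchor as a bracket morphism; projectable sections; brackets of lifts. -/

section Brackets

variable {EM : Type*} [NormedAddCommGroup EM] [NormedSpace ℝ EM] [FiniteDimensional ℝ EM]
  {H : Type*} [TopologicalSpace H] {I : ModelWithCorners ℝ EM H} [I.Boundaryless]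
  {M : Type*} [TopologicalSpace M] [T2Space M] [ChartedSpace H M] [IsManifold I ∞ M]
  {F : Type*} [NormedAddCommGroup F] [NormedSpace ℝ F] [FiniteDimensional ℝ F]
  {E : M → Type*} [TopologicalSpace (TotalSpace F E)]
  [∀ x, AddCommGroup (E x)] [∀ x, Module ℝ (E x)] [∀ x, TopologicalSpace (E x)]
  [FiberBundle F E] [VectorBundle ℝ F E] [ContMDiffVectorBundle ∞ F E I]

/-- The derivative of a smooth function along the anchor of a section. -/
def LieAlgebroid.anchorDeriv (A : LieAlgebroid I F E) (σ : Sec I F E)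
    (f : C^∞⟮I, M; 𝓘(ℝ, ℝ), ℝ⟯) : C^∞⟮I, M; 𝓘(ℝ, ℝ), ℝ⟯ :=
  ⟨fun x => dAt I f x (A.anchor.toFun x (σ x)),
    contMDiff_dAt f.contMDiff (A.anchor.smooth.comp σ.contMDiff)⟩

theorem LieAlgebroid.bracket_smulSec (A : LieAlgebroid I F E) (σ η : Sec I F E)
    (f : C^∞⟮I, M; 𝓘(ℝ, ℝ), ℝ⟯) :
    A.bracket σ (smulSec f η) = smulSec f (A.bracket σ η) + smulSec (A.anchorDeriv σ f) η := by
  ext x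
  exact A.leibniz σ η f x

/-- The anchor maps the bracket of sections to the commutator of derivations. -/
theorem LieAlgebroid.dAt_anchor_bracket (A : LieAlgebroid I F E) (σ η : Sec I F E)
    (f : C^∞⟮I, M; 𝓘(ℝ, ℝ), ℝ⟯) (x : M) :
    dAt I f x (A.anchor.toFun x (A.bracket σ η x))
      = dAt I (A.anchorDeriv η f) x (A.anchor.toFun x (σ x))
        - dAt I (A.anchorDeriv σ f) x (A.anchor.toFun x (η x)) := by
  -- If the fibre is zero both sides vanish; otherwise a section ζ with ζ(x) ≠ 0 is available to
  -- detect scalars.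
  by_cases h0 : ∀ v : E x, v = 0
  · rw [h0 (A.bracket σ η x), h0 (σ x), h0 (η x)]
    simp
  push Not at h0
  obtain ⟨v, hv⟩ := h0
  obtain ⟨ζ, rfl⟩ := exists_sec_eq (I := I) (F := F) x v
  have jac : ∀ θ : Sec I F E, A.bracket (A.bracket σ η) θ
      = A.bracket σ (A.bracket η θ) - A.bracket η (A.bracket σ θ) := by
    intro θ
    have h := A.jacobi σ η θ
    rw [A.bracket_swap σ θ, A.bracket_swap (A.bracket σ η) θ, map_neg] at h
    rw [← sub_eq_zero, ← neg_eq_zero, ← h]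
    abel
  -- Expanding Jacobi on f ζ by the Leibniz rule, everything cancels except a multiple of ζ(x),
  -- whose coefficient is the defect to be shown zero.
  have h1 := jac (smulSec f ζ)
  rw [A.bracket_smulSec, A.bracket_smulSec, A.bracket_smulSec, jac ζ, map_add, map_add,
    A.bracket_smulSec, A.bracket_smulSec, A.bracket_smulSec, A.bracket_smulSec] at h1
  have h2 := congrArg (fun s : Sec I F E => s x) h1
  simp only [ContMDiffSection.coe_add, ContMDiffSection.coe_sub, Pi.add_apply,
    Pi.sub_apply] at h2
  change f x • (A.bracket σ (A.bracket η ζ) x - A.bracket η (A.bracket σ ζ) x)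
      + dAt I f x (A.anchor.toFun x (A.bracket σ η x)) • ζ x
    = (f x • A.bracket σ (A.bracket η ζ) x + A.anchorDeriv σ f x • A.bracket η ζ x
        + (A.anchorDeriv η f x • A.bracket σ ζ x
          + dAt I (A.anchorDeriv η f) x (A.anchor.toFun x (σ x)) • ζ x))
      - (f x • A.bracket η (A.bracket σ ζ) x + A.anchorDeriv η f x • A.bracket σ ζ x
        + (A.anchorDeriv σ f x • A.bracket η ζ x
          + dAt I (A.anchorDeriv σ f) x (A.anchor.toFun x (η x)) • ζ x)) at h2
  have h3 : (dAt I f x (A.anchor.toFun x (A.bracket σ η x))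
      - (dAt I (A.anchorDeriv η f) x (A.anchor.toFun x (σ x))
        - dAt I (A.anchorDeriv σ f) x (A.anchor.toFun x (η x)))) • ζ x = 0 := by
    rw [sub_smul, sub_smul, sub_eq_zero, ← add_right_inj
      (f x • (A.bracket σ (A.bracket η ζ) x - A.bracket η (A.bracket σ ζ) x)), h2, smul_sub]
    abel
  exact sub_eq_zero.1 ((smul_eq_zero.1 h3).resolve_right hv)

/-- The bracket of two vector fields on the total space that project to the anchors of sections
projects to the anchor of the bracket. -/
theorem tangentProj_mlieBracket (A : LieAlgebroid I F E) (σ η : Sec I F E)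
    {X Y : ∀ q : TotalSpace F E, TangentSpace (I.prod 𝓘(ℝ, F)) q}
    (hX : ContMDiff (I.prod 𝓘(ℝ, F)) (I.prod 𝓘(ℝ, F)).tangent ∞
      (fun q => (⟨q, X q⟩ : TangentBundle (I.prod 𝓘(ℝ, F)) (TotalSpace F E))))
    (hY : ContMDiff (I.prod 𝓘(ℝ, F)) (I.prod 𝓘(ℝ, F)).tangent ∞
      (fun q => (⟨q, Y q⟩ : TangentBundle (I.prod 𝓘(ℝ, F)) (TotalSpace F E))))
    (hXσ : ∀ q, tangentProj I q (X q) = A.anchor.toFun q.proj (σ q.proj))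
    (hYη : ∀ q, tangentProj I q (Y q) = A.anchor.toFun q.proj (η q.proj)) (q : TotalSpace F E) :
    tangentProj I q (mlieBracket (I.prod 𝓘(ℝ, F)) X Y q)
      = A.anchor.toFun q.proj (A.bracket σ η q.proj) := by
  rw [← sub_eq_zero]
  refine eq_zero_of_forall_dAt fun f => ?_
  have hd : ∀ (g : C^∞⟮I, M; 𝓘(ℝ, ℝ), ℝ⟯) (p : TotalSpace F E)
      (v : TangentSpace (I.prod 𝓘(ℝ, F)) p),
      dAt (I.prod 𝓘(ℝ, F)) (fun p : TotalSpace F E => g p.proj) p v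
        = dAt I g p.proj (tangentProj I p v) := fun g p v =>
    dAt_comp_proj (g.contMDiff.mdifferentiableAt (by simp)) v
  -- On functions pulled back from M, X and Y act as the anchors of σ and η, and the results are
  -- again pullbacks, so the commutator is computed on M.
  have hXf : (fun p : TotalSpace F E => dAt (I.prod 𝓘(ℝ, F))
      (fun p : TotalSpace F E => f p.proj) p (X p)) = fun p => A.anchorDeriv σ f p.proj := by
    funext p
    rw [hd, hXσ]
    rfl
  have hYf : (fun p : TotalSpace F E => dAt (I.prod 𝓘(ℝ, F))
      (fun p : TotalSpace F E => f p.proj) p (Y p)) = fun p => A.anchorDeriv η f p.proj := by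
    funext p
    rw [hd, hYη]
    rfl
  rw [map_sub, ← hd, A.dAt_anchor_bracket,
    dAt_mlieBracket (f := fun p : TotalSpace F E => f p.proj)
      (f.contMDiff.comp (contMDiff_proj E)) hX hY, hXf, hYf, hd, hd, hXσ, hYη,
    sub_self]

/-- The bracket of projectable sections of `𝒯^E E` exists. -/
theorem ProjSec.exists_isBracket (A : LieAlgebroid I F E) (Z W : ProjSec F E A.anchor) :
    ∃ V : ProjSec F E A.anchor, ProjSec.IsBracket A Z W V := by
  have h1 : IsManifold (I.prod 𝓘(ℝ, F)) (minSmoothness ℝ 2) (TotalSpace F E) := by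
    rw [minSmoothness_of_isRCLikeNormedField]
    exact IsManifold.of_le (n := ∞) (by norm_cast)
  have h2 : IsManifold (I.prod 𝓘(ℝ, F)) (((⊤ : ℕ∞) : WithTop ℕ∞) + 1) (TotalSpace F E) :=
    IsManifold.of_le (n := ∞) (by simp)
  exact ⟨{
    base := A.bracket Z.base W.base
    field := ⟨mlieBracket (I.prod 𝓘(ℝ, F)) Z.field W.field,
      ContDiff.mlieBracket_vectorField (m := ⊤) (n := ⊤) Z.field.contMDiff W.field.contMDiff
        (by rw [minSmoothness_of_isRCLikeNormedField]; simp)⟩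
    related := fun p => (tangentProj_mlieBracket A _ _ Z.field.contMDiff W.field.contMDiff
      (fun q => (Z.related q).symm) (fun q => (W.related q).symm) p).symm }, rfl, fun _ => rfl⟩

/-- The complete lift as a projectable section. -/
def completeLiftSec (A : LieAlgebroid I F E) (σ : Sec I F E) : ProjSec F E A.anchor where
  base := σ
  field := ⟨completeLiftField A σ, contMDiff_completeLiftField A σ⟩
  related := fun p => (tangentProj_completeLiftField A σ p).symm

theorem completeLiftSec_val (A : LieAlgebroid I F E) (σ : Sec I F E) (a : TotalSpace F E) :
    (completeLiftSec A σ).val a = completeLift A σ a :=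
  Subtype.ext (Prod.ext (completeLift_fst A σ a).symm rfl)

/-- Every element of `𝒯^E E` is the value of a projectable section. -/
theorem ProjSec.exists_val_eq (A : LieAlgebroid I F E) {a : TotalSpace F E}
    (z : Prol A.anchor a) : ∃ Z : ProjSec F E A.anchor, Z.val a = z := by
  have h1 : IsManifold (I.prod 𝓘(ℝ, F)) 1 (TotalSpace F E) := IsManifold.of_le (n := ∞) (by simp)
  obtain ⟨σ, hσ⟩ := exists_sec_eq (I := I) (F := F) a.proj z.1.1
  have hz : A.anchor.toFun a.proj z.1.1 = tangentProj I a z.1.2 := z.2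
  -- The complete lift of a section through the E-component has the right projection; the vertical
  -- error is corrected by a vertical lift.
  obtain ⟨b, hb⟩ := exists_verticalVec_eq (I := I) (q := a) (v := z.1.2 - completeLiftField A σ a)
    (by rw [map_sub, ← hz, tangentProj_completeLiftField, hσ, sub_self])
  obtain ⟨β, rfl⟩ := exists_sec_eq (I := I) (F := F) a.proj b
  refine ⟨{
    base := σ
    field := ⟨fun q => completeLiftField A σ q + verticalVec (I := I) q (β q.proj),
      (contMDiff_completeLiftField A σ).add_section (contMDiff_verticalVec_sec β)⟩
    related := fun p => ?_ }, ?_⟩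
  · refine Eq.trans ?_ (map_add (tangentProj I p) _ _).symm
    rw [tangentProj_completeLiftField, tangentProj_verticalVec, add_zero]
  · refine Subtype.ext (Prod.ext hσ ?_)
    show completeLiftField A σ a + verticalVec (I := I) a (β a.proj) = z.1.2
    rw [hb, add_sub_cancel]

/-- The function differentiated here is the fibrewise linear function of d_η μ, hence affine along
lines in the fibre. -/
theorem dAt_dAt_hat_verticalVec (A : LieAlgebroid I F E) (η : Sec I F E) (μ : DualSec I F E)
    (a : TotalSpace F E) (b : Sec I F E) :
    dAt (I.prod 𝓘(ℝ, F)) (fun q => dAt (I.prod 𝓘(ℝ, F)) μ.hat q (completeLiftField A η q)) a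
      (verticalVec (I := I) a (b a.proj)) = A.lieDeriv η μ b a.proj := by
  refine dAt_verticalVec_of_forall_add
    ((contMDiff_dAt μ.contMDiff_hat (contMDiff_completeLiftField A η)).mdifferentiableAt (by simp)) _ _
    fun t => ?_
  obtain ⟨s, hs⟩ := exists_sec_eq (I := I) (F := F) a.proj a.2
  have h1 := dAt_hat_completeLiftField A η μ (η := s + t • b)
    (a := (⟨a.proj, a.2 + t • b a.proj⟩ : TotalSpace F E)) (by
      rw [ContMDiffSection.coe_add, ContMDiffSection.coe_smul, Pi.add_apply, Pi.smul_apply, hs])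
  rw [h1, dAt_hat_completeLiftField A η μ hs]
  show A.lieDerivAt η μ a.proj (s + t • b) = A.lieDerivAt η μ a.proj s
    + t * A.lieDerivAt η μ a.proj b
  rw [map_add, map_smul, smul_eq_mul]

/-- The bracket of a complete lift and a vertical lift is the vertical lift of the bracket. -/
theorem mlieBracket_completeLiftField_verticalVec (A : LieAlgebroid I F E) (η b : Sec I F E)
    (a : TotalSpace F E) :
    mlieBracket (I.prod 𝓘(ℝ, F)) (completeLiftField A η)
        (fun q => verticalVec (I := I) q (b q.proj)) a
      = verticalVec (I := I) a (A.bracket η b a.proj) := by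
  rw [← sub_eq_zero]
  have hc := contMDiff_completeLiftField A η
  have hv := contMDiff_verticalVec_sec b
  refine eq_zero_of_forall_dAt_proj_hat ?_ fun μ => ?_
  -- A vertical field projects to the anchor of the zero section, and [η, 0] = 0.
  · rw [map_sub, tangentProj_verticalVec, sub_zero, tangentProj_mlieBracket A η 0 hc hv
      (tangentProj_completeLiftField A η) (fun q => by
        rw [tangentProj_verticalVec, ContMDiffSection.coe_zero, Pi.zero_apply, map_zero]),
      map_zero, ContMDiffSection.coe_zero, Pi.zero_apply, map_zero]
  · have h1 : (fun q : TotalSpace F E => dAt (I.prod 𝓘(ℝ, F)) μ.hat q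
        (verticalVec (I := I) q (b q.proj))) = fun q => μ.toFun q.proj (b q.proj) :=
      funext fun q => μ.dAt_hat_verticalVec q _
    -- On μ̂ the bracket gives ρ(η)⟨μ, b⟩ - ⟨d_η μ, b⟩ = ⟨μ, [η, b]⟩.
    rw [map_sub, μ.dAt_hat_verticalVec, dAt_mlieBracket μ.contMDiff_hat hc hv, dAt_dAt_hat_verticalVec, h1,
      dAt_comp_proj (f := fun x => μ.toFun x (b x))
        ((μ.contMDiff_apply b).mdifferentiableAt (by simp)), tangentProj_completeLiftField]
    unfold LieAlgebroid.lieDeriv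
    ring

/-- Complete lifts commute with the Liouville vector field. -/
theorem mlieBracket_completeLiftField_liouville (A : LieAlgebroid I F E) (η : Sec I F E)
    (a : TotalSpace F E) :
    mlieBracket (I.prod 𝓘(ℝ, F)) (completeLiftField A η)
        (fun q => verticalVec (I := I) q q.2) a = 0 := by
  have hc := contMDiff_completeLiftField A η
  have hv : ContMDiff (I.prod 𝓘(ℝ, F)) (I.prod 𝓘(ℝ, F)).tangent ∞
      (fun q : TotalSpace F E => (⟨q, verticalVec (I := I) q q.2⟩ :
        TangentBundle (I.prod 𝓘(ℝ, F)) (TotalSpace F E))) :=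
    contMDiff_verticalVec (V := fun q => q.2) contMDiff_id
  refine eq_zero_of_forall_dAt_proj_hat ?_ fun μ => ?_
  · rw [tangentProj_mlieBracket A η 0 hc hv
      (tangentProj_completeLiftField A η) (fun q => by
        rw [tangentProj_verticalVec, ContMDiffSection.coe_zero, Pi.zero_apply, map_zero]),
      map_zero, ContMDiffSection.coe_zero, Pi.zero_apply, map_zero]
  · have h1 : (fun q : TotalSpace F E => dAt (I.prod 𝓘(ℝ, F)) μ.hat q
        (verticalVec (I := I) q q.2)) = μ.hat :=
      funext fun q => μ.dAt_hat_verticalVec q _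
    obtain ⟨b, hb⟩ := exists_sec_eq (I := I) (F := F) a.proj a.2
    -- Both μ̂ and η^c(μ̂) are fibrewise linear, so Δ fixes them. At a, Δ is the vertical lift of
    -- the section b through a.
    rw [dAt_mlieBracket μ.contMDiff_hat hc hv, h1, dAt_hat_completeLiftField A η μ hb, ← hb,
      dAt_dAt_hat_verticalVec, sub_self]

end Brackets

/-! ### Existence of dθ_L and the contraction identity. -/

section CartanForms

variable {EM : Type*} [NormedAddCommGroup EM] [NormedSpace ℝ EM] [FiniteDimensional ℝ EM]
  {H : Type*} [TopologicalSpace H] {I : ModelWithCorners ℝ EM H} [I.Boundaryless]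
  {M : Type*} [TopologicalSpace M] [T2Space M] [ChartedSpace H M] [IsManifold I ∞ M]
  {F : Type*} [NormedAddCommGroup F] [NormedSpace ℝ F] [FiniteDimensional ℝ F]
  {E : M → Type*} [TopologicalSpace (TotalSpace F E)]
  [∀ x, AddCommGroup (E x)] [∀ x, Module ℝ (E x)] [∀ x, TopologicalSpace (E x)]
  [FiberBundle F E] [VectorBundle ℝ F E] [ContMDiffVectorBundle ∞ F E I]

/-- The part of `dθ_L(z₁, z₂)` that depends on the section through the second argument. -/
def cartanAux (A : LieAlgebroid I F E) {L : TotalSpace F E → ℝ}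
    (hL : ContMDiff (I.prod 𝓘(ℝ, F)) 𝓘(ℝ, ℝ) ∞ L) (p : TotalSpace F E) (σ : Sec I F E)
    (v : TangentSpace (I.prod 𝓘(ℝ, F)) p) : Sec I F E →ₗ[ℝ] ℝ where
  toFun η := dAt (I.prod 𝓘(ℝ, F)) (vertDeriv L η) p v - vertDeriv L (A.bracket σ η) p
  map_add' η ζ := by
    rw [dAt_vertDeriv_add hL, map_add, vertDeriv_add]
    ring
  map_smul' c η := by
    rw [dAt_vertDeriv_smul hL, map_smul, vertDeriv_smul, smul_eq_mul, RingHom.id_apply]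
    ring

/-- Tensoriality again: v projects to ρ(σ), so v(f∘π) from the product rule cancels ρ(σ)f from the
Leibniz rule. -/
theorem cartanAux_congr (A : LieAlgebroid I F E) {L : TotalSpace F E → ℝ}
    (hL : ContMDiff (I.prod 𝓘(ℝ, F)) 𝓘(ℝ, ℝ) ∞ L) {p : TotalSpace F E} {σ : Sec I F E}
    {v : TangentSpace (I.prod 𝓘(ℝ, F)) p}
    (hv : A.anchor.toFun p.proj (σ p.proj) = tangentProj I p v) {η ζ : Sec I F E}
    (h : η p.proj = ζ p.proj) : cartanAux A hL p σ v η = cartanAux A hL p σ v ζ := by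
  rw [← sub_eq_zero, ← map_sub]
  refine map_eq_zero_of_apply_eq_zero (x₀ := p.proj) _ ?_ ?_
  · intro f θ hf
    have hsm : ∀ (g : C^∞⟮I, M; 𝓘(ℝ, ℝ), ℝ⟯) (θ : Sec I F E), vertDeriv L (smulSec g θ)
        = fun q => g q.proj * vertDeriv L θ q := by
      intro g θ
      funext q
      unfold vertDeriv
      rw [← smul_eq_mul, ← map_smul, ← (verticalVec_linear q).map_smul]
      rfl
    show dAt (I.prod 𝓘(ℝ, F)) (vertDeriv L (smulSec f θ)) p v
      - vertDeriv L (A.bracket σ (smulSec f θ)) p = 0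
    have hfp : MDifferentiableAt (I.prod 𝓘(ℝ, F)) 𝓘(ℝ, ℝ) (fun q : TotalSpace F E => f q.proj) p :=
      (f.contMDiff.comp (contMDiff_proj E)).mdifferentiableAt (by simp)
    rw [A.bracket_smulSec, vertDeriv_add, hsm, hsm, hsm, dAt_mul hfp
      ((contMDiff_vertDeriv hL θ).mdifferentiableAt (by simp)),
      dAt_comp_proj (f.contMDiff.mdifferentiableAt (by simp)), ← hv, hf]
    show _ - (_ + dAt I f p.proj (A.anchor.toFun p.proj (σ p.proj)) * vertDeriv L θ p) = 0
    linear_combination -(vertDeriv L (A.bracket σ θ) p) * hf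
  · rw [ContMDiffSection.coe_sub, Pi.sub_apply, h, sub_self]

/-- A linear right inverse of evaluation at x. Linearity of the choice makes a 2-form defined
through it bilinear. -/
theorem exists_linear_extension (x : M) :
    ∃ s : E x →ₗ[ℝ] Sec I F E, ∀ v, s v x = v := by
  let ev : Sec I F E →ₗ[ℝ] E x :=
    { toFun := fun σ => σ x
      map_add' := fun _ _ => rfl
      map_smul' := fun _ _ => rfl }
  obtain ⟨s, hs⟩ := ev.exists_rightInverse_of_surjective
    (LinearMap.range_eq_top.2 fun v => exists_sec_eq x v)
  exact ⟨s, fun v => DFunLike.congr_fun hs v⟩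

/-- The Cartan 1-form of a smooth Lagrangian has an exterior differential. -/
theorem exists_isExtDeriv_cartanOne (A : LieAlgebroid I F E) {L : TotalSpace F E → ℝ}
    (hL : ContMDiff (I.prod 𝓘(ℝ, F)) 𝓘(ℝ, ℝ) ∞ L) :
    ∃ β, IsExtDeriv A (cartanOne A L) β := by
  choose s hs using fun x : M => exists_linear_extension (I := I) (F := F) (E := E) x
  have haux : ∀ (p : TotalSpace F E) (σ η : Sec I F E) (v : TangentSpace (I.prod 𝓘(ℝ, F)) p),
      cartanAux A hL p σ v η
        = dAt (I.prod 𝓘(ℝ, F)) (vertDeriv L η) p v - vertDeriv L (A.bracket σ η) p :=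
    fun _ _ _ _ => rfl
  refine ⟨fun p => LinearMap.mk₂ ℝ (fun z w : Prol A.anchor p =>
    cartanAux A hL p (s p.proj z.1.1) z.1.2 (s p.proj w.1.1)
      - dAt (I.prod 𝓘(ℝ, F)) (vertDeriv L (s p.proj z.1.1)) p w.1.2) ?_ ?_ ?_ ?_, ?_⟩
  · intro z z' w
    simp only [haux, Submodule.coe_add, Prod.fst_add, Prod.snd_add, map_add, LinearMap.add_apply,
      vertDeriv_add, dAt_vertDeriv_add hL]
    ring
  · intro c z w
    simp only [haux, Submodule.coe_smul, Prod.smul_fst, Prod.smul_snd, map_smul,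
      LinearMap.smul_apply, vertDeriv_smul, dAt_vertDeriv_smul hL,
      smul_eq_mul]
    ring
  · intro z w w'
    simp only [Submodule.coe_add, Prod.fst_add, Prod.snd_add, map_add]
    ring
  · intro c z w
    simp only [Submodule.coe_smul, Prod.smul_fst, Prod.smul_snd, map_smul, smul_eq_mul]
    ring
  · intro Z W V hV p
    show cartanAux A hL p (s p.proj (Z.base p.proj)) (Z.field p) (s p.proj (W.base p.proj))
        - dAt (I.prod 𝓘(ℝ, F)) (vertDeriv L (s p.proj (Z.base p.proj))) p (W.field p)
      = dAt (I.prod 𝓘(ℝ, F)) (vertDeriv L W.base) p (Z.field p)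
        - dAt (I.prod 𝓘(ℝ, F)) (vertDeriv L Z.base) p (W.field p) - vertDeriv L V.base p
    -- The chosen extensions are exchanged for the actual base sections one argument at a time:
    -- first that of W, then that of Z with the roles swapped by antisymmetry of the bracket.
    have h1 := cartanAux_congr A hL (p := p) (σ := s p.proj (Z.base p.proj)) (v := Z.field p)
      (by rw [hs]; exact Z.related p) (hs p.proj (W.base p.proj))
    have h2 := cartanAux_congr A hL (p := p) (σ := W.base) (v := W.field p)
      (W.related p) (hs p.proj (Z.base p.proj))
    have h3 : ∀ σ : Sec I F E, vertDeriv L (A.bracket W.base σ) p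
        = -vertDeriv L (A.bracket σ W.base) p := by
      intro σ
      rw [A.bracket_swap, ← neg_one_smul ℝ, vertDeriv_smul]
      ring
    rw [h1, hV.1, haux]
    rw [haux, haux, h3, h3] at h2
    linarith

/-- The Cartan 2-form on the values of projectable sections. -/
theorem cartanTwo_val (A : LieAlgebroid I F E) {L : TotalSpace F E → ℝ}
    (hL : ContMDiff (I.prod 𝓘(ℝ, F)) 𝓘(ℝ, ℝ) ∞ L) (Z W : ProjSec F E A.anchor)
    (p : TotalSpace F E) :
    cartanTwo A L p (Z.val p) (W.val p)
      = dAt (I.prod 𝓘(ℝ, F)) (vertDeriv L Z.base) p (W.field p)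
        - dAt (I.prod 𝓘(ℝ, F)) (vertDeriv L W.base) p (Z.field p)
        + vertDeriv L (A.bracket Z.base W.base) p := by
  have h := Classical.epsilon_spec (exists_isExtDeriv_cartanOne A hL)
  obtain ⟨V, hV⟩ := ProjSec.exists_isBracket A Z W
  have h1 : extDeriv A (cartanOne A L) p (Z.val p) (W.val p)
      = dAt (I.prod 𝓘(ℝ, F)) (vertDeriv L W.base) p (Z.field p)
        - dAt (I.prod 𝓘(ℝ, F)) (vertDeriv L Z.base) p (W.field p) - vertDeriv L V.base p :=
    h Z W V hV p
  show -extDeriv A (cartanOne A L) p (Z.val p) (W.val p) = _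
  rw [h1, hV.1]
  ring

/-- For `z` with `S z = Δ`, the contraction of `ω_L` with `z` and a complete lift. -/
theorem cartanTwo_sub_dFun_energy (A : LieAlgebroid I F E) {L : TotalSpace F E → ℝ}
    (hL : ContMDiff (I.prod 𝓘(ℝ, F)) 𝓘(ℝ, ℝ) ∞ L) (η : Sec I F E) {a : TotalSpace F E}
    (z : Prol A.anchor a) (hz : verticalEnd A.anchor a z = liouville A.anchor a) :
    cartanTwo A L a z (completeLift A η a)
        - Prol.dFun A.anchor (energy A L) a (completeLift A η a)
      = Prol.dFun A.anchor L a (completeLift A η a)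
        - dAt (I.prod 𝓘(ℝ, F)) (vertDeriv L η) a z.1.2 := by
  obtain ⟨Z, rfl⟩ := ProjSec.exists_val_eq A z
  -- The tangent component of S z = Δ: s^V and Δ agree at the point a, which suffices because only a
  -- derivative at a is compared.
  have hZ : verticalVec (I := I) a (Z.base a.proj) = verticalVec (I := I) a a.2 :=
    congrArg (fun w : Prol A.anchor a => w.1.2) hz
  have hc := contMDiff_completeLiftField A η
  have hl : ContMDiff (I.prod 𝓘(ℝ, F)) (I.prod 𝓘(ℝ, F)).tangent ∞
      (fun q : TotalSpace F E => (⟨q, verticalVec (I := I) q q.2⟩ :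
        TangentBundle (I.prod 𝓘(ℝ, F)) (TotalSpace F E))) :=
    contMDiff_verticalVec (V := fun q => q.2) contMDiff_id
  have h1 := cartanTwo_val A hL Z (completeLiftSec A η) a
  rw [completeLiftSec_val] at h1
  have h2 := dAt_mlieBracket hL hc (contMDiff_verticalVec_sec Z.base) a
  rw [mlieBracket_completeLiftField_verticalVec, hZ] at h2
  have h3 := dAt_mlieBracket hL hc hl a
  rw [mlieBracket_completeLiftField_liouville, map_zero] at h3
  have h4 : Prol.dFun A.anchor (energy A L) a (completeLift A η a)
      = dAt (I.prod 𝓘(ℝ, F)) (fun q => dAt (I.prod 𝓘(ℝ, F)) L q (verticalVec (I := I) q q.2)) a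
          (completeLiftField A η a) - dAt (I.prod 𝓘(ℝ, F)) L a (completeLiftField A η a) :=
    dAt_sub ((contMDiff_dAt hL hl).mdifferentiableAt (by simp))
      (hL.mdifferentiableAt (by simp)) _
  have h5 : vertDeriv L (A.bracket Z.base η) a
      = -dAt (I.prod 𝓘(ℝ, F)) L a (verticalVec (I := I) a (A.bracket η Z.base a.proj)) := by
    rw [A.bracket_swap η, ← neg_one_smul ℝ, vertDeriv_smul, neg_one_mul]
    rfl
  rw [h1, h4]
  change dAt (I.prod 𝓘(ℝ, F)) (vertDeriv L Z.base) a (completeLiftField A η a)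
      - dAt (I.prod 𝓘(ℝ, F)) (vertDeriv L η) a (Z.field a)
      + vertDeriv L (A.bracket Z.base η) a - _
    = dAt (I.prod 𝓘(ℝ, F)) L a (completeLiftField A η a)
      - dAt (I.prod 𝓘(ℝ, F)) (vertDeriv L η) a (Z.field a)
  rw [h5, h2]
  change dAt (I.prod 𝓘(ℝ, F)) (vertDeriv L Z.base) a (completeLiftField A η a)
      - dAt (I.prod 𝓘(ℝ, F)) (vertDeriv L η) a (Z.field a)
      + -(dAt (I.prod 𝓘(ℝ, F)) (vertDeriv L Z.base) a (completeLiftField A η a) - _) - _ = _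
  linarith

end CartanForms

/-! ### Invariance along integral curves. -/

section ConstantsOfMotion

variable {EM : Type*} [NormedAddCommGroup EM] [NormedSpace ℝ EM]
  {H : Type*} [TopologicalSpace H] {I : ModelWithCorners ℝ EM H}
  {M : Type*} [TopologicalSpace M] [ChartedSpace H M]

/-- A function annihilated by a vector field is constant along its integral curves. -/
theorem eq_of_isMIntegralCurveOn {f : M → ℝ} (hf : MDifferentiable I 𝓘(ℝ, ℝ) f)
    {X : ∀ x : M, TangentSpace I x} (hX : ∀ x, dAt I f x (X x) = 0) {γ : ℝ → M} {s : Set ℝ}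
    (hs : s.OrdConnected) (hγ : IsMIntegralCurveOn (I := I) γ X s) {t t' : ℝ} (ht : t ∈ s)
    (ht' : t' ∈ s) : f (γ t) = f (γ t') := by
  have hd : ∀ r ∈ s, HasFDerivWithinAt (fun r => f (γ r)) (0 : ℝ →L[ℝ] ℝ) s r := by
    intro r hr
    have h1 := ((hf (γ r)).hasMFDerivAt.comp_hasMFDerivWithinAt r (hγ r hr)).hasFDerivWithinAt
    refine h1.congr_fderiv ?_
    ext
    refine Eq.trans ?_ (hX (γ r))
    refine congrArg (mfderiv I 𝓘(ℝ, ℝ) f (γ r) : EM →L[ℝ] ℝ) ?_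
    exact one_smul ℝ (X (γ r) : EM)
  -- Mean value inequality with bound 0; derivatives within s allow intervals with endpoints.
  have h := hs.convex.norm_image_sub_le_of_norm_hasFDerivWithin_le (C := 0) hd
    (fun r _ => by simp) ht' ht
  rw [zero_mul, norm_le_zero_iff, sub_eq_zero] at h
  exact h

end ConstantsOfMotion

/-! ### Restriction to D and the momentum equation. -/

section MomentumEquation

variable {EM : Type*} [NormedAddCommGroup EM] [NormedSpace ℝ EM] [FiniteDimensional ℝ EM]
  {H : Type*} [TopologicalSpace H] {I : ModelWithCorners ℝ EM H} [I.Boundaryless]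
  {M : Type*} [TopologicalSpace M] [T2Space M] [ChartedSpace H M] [IsManifold I ∞ M]
  {F : Type*} [NormedAddCommGroup F] [NormedSpace ℝ F] [FiniteDimensional ℝ F]
  {E : M → Type*} [TopologicalSpace (TotalSpace F E)]
  [∀ x, AddCommGroup (E x)] [∀ x, Module ℝ (E x)] [∀ x, TopologicalSpace (E x)]
  [FiberBundle F E] [VectorBundle ℝ F E] [ContMDiffVectorBundle ∞ F E I]
  {FD : Type*} [NormedAddCommGroup FD] [NormedSpace ℝ FD]
  {D : M → Type*} [TopologicalSpace (TotalSpace FD D)]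
  [∀ x, AddCommGroup (D x)] [∀ x, Module ℝ (D x)] [∀ x, TopologicalSpace (D x)]
  [FiberBundle FD D] [VectorBundle ℝ FD D] [ContMDiffVectorBundle ∞ FD D I]
  {FK : Type*} [NormedAddCommGroup FK] [NormedSpace ℝ FK]
  {K : M → Type*} [TopologicalSpace (TotalSpace FK K)]
  [∀ x, AddCommGroup (K x)] [∀ x, Module ℝ (K x)] [∀ x, TopologicalSpace (K x)]
  [FiberBundle FK K] [VectorBundle ℝ FK K] [ContMDiffVectorBundle ∞ FK K I]

/-- This inclusion acts on tangent components by the tangent map of the identity of D. -/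
theorem anchor_inclTED (A : LieAlgebroid I F E) (i : BundleMor I FD D F E)
    (d : TotalSpace FD D) (z : Prol (A.anchor.comp i) d) :
    (inclTED A i d z).1.2 = z.1.2 := by
  have h : mfderiv (I.prod 𝓘(ℝ, FD)) (I.prod 𝓘(ℝ, FD))
      (BundleMor.id (I := I) (F := FD) (E := D)).total d = ContinuousLinearMap.id ℝ _ :=
    mfderiv_id
  exact DFunLike.congr_fun h z.1.2

/-- The differential along `𝒯^D D` of the restriction to `D` of a function on `E`. -/
theorem dFun_comp_total (A : LieAlgebroid I F E) (i : BundleMor I FD D F E)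
    {f : TotalSpace F E → ℝ} (hf : ContMDiff (I.prod 𝓘(ℝ, F)) 𝓘(ℝ, ℝ) ∞ f)
    (d : TotalSpace FD D) (z : Prol (A.anchor.comp i) d) :
    Prol.dFun A.anchor (fun d' => f (i.total d')) d (inclTED A i d z)
      = dAt (I.prod 𝓘(ℝ, F)) f (i.total d) (inclTEE A i d z).1.2 := by
  have h1 : ContMDiff (I.prod 𝓘(ℝ, FD)) (I.prod 𝓘(ℝ, F)) ∞ i.total := i.smooth
  refine Eq.trans (congrArg (dAt (I.prod 𝓘(ℝ, FD)) (fun d' => f (i.total d')) d)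
    (anchor_inclTED A i d z)) ?_
  exact dAt_comp (hf.mdifferentiableAt (by simp)) (h1.mdifferentiableAt (by simp)) _

theorem nhMomentumAlong_eq_vertDeriv (A : LieAlgebroid I F E) (L : TotalSpace F E → ℝ)
    (i : BundleMor I FD D F E) (Ψ : BundleMor I FK K F E) (σ : Sec I FK K)
    (hσ : ∀ x, σ x ∈ KD i Ψ x) :
    nhMomentumAlong A L i Ψ σ hσ = vertDeriv L (Ψ.mapSec σ) := rfl

/-- The nonholonomic momentum equation. -/
theorem dFun_nhMomentumAlong (A : LieAlgebroid I F E) {L : TotalSpace F E → ℝ}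
    (hL : ContMDiff (I.prod 𝓘(ℝ, F)) 𝓘(ℝ, ℝ) ∞ L) (i : BundleMor I FD D F E)
    {Γ : ∀ d : TotalSpace FD D, Prol (A.anchor.comp i) d} (hΓ : IsConstrainedSolution A L i Γ)
    (Ψ : BundleMor I FK K F E) (σ : Sec I FK K) (hσ : ∀ x, σ x ∈ KD i Ψ x)
    (d : TotalSpace FD D) :
    Prol.dFun A.anchor (fun d' => nhMomentumAlong A L i Ψ σ hσ (i.total d')) d
        (inclTED A i d (Γ d))
      = Prol.dFun A.anchor L (i.total d) (completeLift A (Ψ.mapSec σ) (i.total d)) := by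
  rw [nhMomentumAlong_eq_vertDeriv, dFun_comp_total A i (contMDiff_vertDeriv hL _)]
  obtain ⟨lam, hlam, hLdA⟩ := hΓ.lagrange_dAlembert d
  -- The complete lift is the test vector; its E-component is Ψ(σ), which lies in D by `hσ`, so the
  -- reaction term vanishes.
  have h1 := hLdA (completeLift A (Ψ.mapSec σ) (i.total d))
  rw [cartanTwo_sub_dFun_energy A hL _ _ (hΓ.sode d)] at h1
  obtain ⟨b, hb⟩ := hσ d.proj
  have h2 : Prol.toE A.anchor (i.total d) (completeLift A (Ψ.mapSec σ) (i.total d))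
      = i.toFun d.proj b := (completeLift_fst A (Ψ.mapSec σ) (i.total d)).trans hb.symm
  rw [h2, hlam, sub_eq_zero] at h1
  exact h1.symm

theorem isConstantOfMotion_nhMomentumAlong (A : LieAlgebroid I F E) {L : TotalSpace F E → ℝ}
    (hL : ContMDiff (I.prod 𝓘(ℝ, F)) 𝓘(ℝ, ℝ) ∞ L) (i : BundleMor I FD D F E)
    {Γ : ∀ d : TotalSpace FD D, Prol (A.anchor.comp i) d} (hΓ : IsConstrainedSolution A L i Γ)
    (Ψ : BundleMor I FK K F E) (σ : Sec I FK K) (hσ : ∀ x, σ x ∈ KD i Ψ x)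
    (h : ∀ d : TotalSpace FD D,
      Prol.dFun A.anchor L (i.total d) (completeLift A (Ψ.mapSec σ) (i.total d)) = 0) :
    IsConstantOfMotion A i Γ (fun d => nhMomentumAlong A L i Ψ σ hσ (i.total d)) := by
  have h0 : ∀ d, Prol.dFun A.anchor (fun d => nhMomentumAlong A L i Ψ σ hσ (i.total d)) d
      (inclTED A i d (Γ d)) = 0 := fun d =>
    (dFun_nhMomentumAlong A hL i hΓ Ψ σ hσ d).trans (h d)
  have hi : ContMDiff (I.prod 𝓘(ℝ, FD)) (I.prod 𝓘(ℝ, F)) ∞ i.total := i.smooth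
  have hs : ContMDiff (I.prod 𝓘(ℝ, FD)) 𝓘(ℝ, ℝ) ∞
      (fun d => nhMomentumAlong A L i Ψ σ hσ (i.total d)) :=
    (contMDiff_vertDeriv hL (Ψ.mapSec σ)).comp hi
  refine ⟨h0, fun γ s hord hγ t ht t' ht' =>
    eq_of_isMIntegralCurveOn (hs.mdifferentiable (by simp)) (fun d => ?_) hord hγ ht ht'⟩
  refine Eq.trans ?_ (h0 d)
  exact congrArg (dAt (I.prod 𝓘(ℝ, FD)) (fun d => nhMomentumAlong A L i Ψ σ hσ (i.total d)) d)
    (anchor_inclTED A i d (Γ d)).symm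

end MomentumEquation

end Nonholonomic

end

theorem mainTheorem8
    {EM : Type*} [NormedAddCommGroup EM] [NormedSpace ℝ EM] [FiniteDimensional ℝ EM]
    {H : Type*} [TopologicalSpace H] {I : ModelWithCorners ℝ EM H} [I.Boundaryless]
    {M : Type*} [TopologicalSpace M] [T2Space M] [SecondCountableTopology M]
    [ChartedSpace H M] [IsManifold I ∞ M]
    {F : Type*} [NormedAddCommGroup F] [NormedSpace ℝ F] [FiniteDimensional ℝ F]
    {E : M → Type*} [TopologicalSpace (TotalSpace F E)]
    [∀ x, AddCommGroup (E x)] [∀ x, Module ℝ (E x)] [∀ x, TopologicalSpace (E x)]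
    [FiberBundle F E] [VectorBundle ℝ F E] [ContMDiffVectorBundle ∞ F E I]
    {FD : Type*} [NormedAddCommGroup FD] [NormedSpace ℝ FD] [FiniteDimensional ℝ FD]
    {D : M → Type*} [TopologicalSpace (TotalSpace FD D)]
    [∀ x, AddCommGroup (D x)] [∀ x, Module ℝ (D x)] [∀ x, TopologicalSpace (D x)]
    [FiberBundle FD D] [VectorBundle ℝ FD D] [ContMDiffVectorBundle ∞ FD D I]
    {FK : Type*} [NormedAddCommGroup FK] [NormedSpace ℝ FK] [FiniteDimensional ℝ FK]
    {K : M → Type*} [TopologicalSpace (TotalSpace FK K)]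
    [∀ x, AddCommGroup (K x)] [∀ x, Module ℝ (K x)] [∀ x, TopologicalSpace (K x)]
    [FiberBundle FK K] [VectorBundle ℝ FK K] [ContMDiffVectorBundle ∞ FK K I]
    (A : Nonholonomic.LieAlgebroid I F E)
    (L : TotalSpace F E → ℝ) (hL : ContMDiff (I.prod 𝓘(ℝ, F)) 𝓘(ℝ, ℝ) ∞ L)
    (hLreg : Nonholonomic.IsRegularLagrangian A L)
    (i : Nonholonomic.BundleMor I FD D F E) (hi : ∀ x, Function.Injective (i.toFun x))
    (hreg : Nonholonomic.IsRegularSystem A L i)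
    (Γ : ∀ d : TotalSpace FD D, Nonholonomic.Prol (A.anchor.comp i) d)
    (hΓ : Nonholonomic.IsConstrainedSolution A L i Γ)
    (Ψ : Nonholonomic.BundleMor I FK K F E)
    (σ : Nonholonomic.Sec I FK K) (hσ : ∀ x, σ x ∈ Nonholonomic.KD i Ψ x) :
    (∀ d : TotalSpace FD D,
      Nonholonomic.Prol.dFun A.anchor
          (fun d' => Nonholonomic.nhMomentumAlong A L i Ψ σ hσ (i.total d')) d
          (Nonholonomic.inclTED A i d (Γ d))
        = Nonholonomic.Prol.dFun A.anchor L (i.total d)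
          (Nonholonomic.completeLift A (Ψ.mapSec σ) (i.total d))) ∧
    ((∀ d : TotalSpace FD D,
        Nonholonomic.Prol.dFun A.anchor L (i.total d)
          (Nonholonomic.completeLift A (Ψ.mapSec σ) (i.total d)) = 0) →
      Nonholonomic.IsConstantOfMotion A i Γ
        (fun d => Nonholonomic.nhMomentumAlong A L i Ψ σ hσ (i.total d))) := by
  exact ⟨fun d => Nonholonomic.dFun_nhMomentumAlong A hL i hΓ Ψ σ hσ d,
    fun h => Nonholonomic.isConstantOfMotion_nhMomentumAlong A hL i hΓ Ψ σ hσ h⟩
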